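/- All graphs are finite, nonnull and loopless, and multiple edges are allowed. For a graph $G$ let $\omega(G)$ denote its number of components. For a real number $t>0$, $G$ is called $t$-tough if $\omega(G\setminus S)\le \max\{1,\tfrac1t|S|\}$ for every $S\subseteq V(G)$. For a positive integer $m$, a graph is called $m$-tree-connected if it has $m$ pairwise edge-disjoint spanning trees. The degree of a vertex is the number of edges incident to it. Let $m\ge 1$ and $r\ge 2m$ be integers and let $t$ be a real number with $$t\ \ge\ \max\Big\{\frac{2m\,r}{r+1-2m},\ r\Big\}.$$ Then every $t$-tough graph $G$ of order $|V(G)|\ge r+1$ has an $m$-tree-connected spanning subgraph $H$ such that $d_H(v)\in\{r,r+1\}$ for every vertex $v$. -/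

import Mathlib

/-!
Parallel edges do not affect toughness, so we may work in the simple graph of adjacency. Toughness
`r` and Tutte's `f`-factor theorem provide a spanning subgraph `F` with all degrees `r`, except
perhaps for one degree `r + 1`. Among the sets `M` of further edges that keep all degrees at most
`r + 1`, take one that brings `F ∪ M` as close as possible to the condition of Nash-Williams and
Tutte for `m` edge-disjoint spanning trees: every partition of the vertices into `k` classes has at
least `m (k - 1)` edges between its classes.

If the condition still fails, then exchange arguments produce a partition with too few edges of
`F ∪ M` between its classes and a set `S` of vertices of degree `r + 1` that meets every unused edge
between different classes. Since all degrees are at least `r`, a class with at most `r` vertices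
sends out at least `r` edges. Deleting `S` and the ends of edges of `F ∪ M` that leave the larger
classes therefore leaves more components than toughness `2 m r / (r + 1 - 2 m)` allows.
-/

open scoped Graph

namespace Graph

variable {α β : Type*}

/-- The degree of a vertex: the number of edges incident with it, a loop being counted twice.
In a loopless graph this is the number of incident edges. -/
noncomputable def vertexDegree (G : Graph α β) (v : α) : ℕ :=
  (G.incidenceSet v).ncard + (G.loopSet v).ncard

/-- Two vertices are joined by a (possibly trivial) walk. -/
def Joined (G : Graph α β) (x y : α) : Prop :=
  x ∈ V(G) ∧ Relation.ReflTransGen G.Adj x y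

/-- The vertex sets of the components of `G`. -/
def componentSets (G : Graph α β) : Set (Set α) :=
  {C | ∃ x ∈ V(G), C = {y | G.Joined x y}}

/-- The number of components of a graph; the null graph has none. -/
noncomputable def numComponents (G : Graph α β) : ℕ :=
  G.componentSets.ncard

/-- A graph is connected if it is nonnull and any two of its vertices are joined by a walk. -/
def IsConnectedGraph (G : Graph α β) : Prop :=
  V(G).Nonempty ∧ ∀ x ∈ V(G), ∀ y ∈ V(G), G.Joined x y

/-- `G` contains a cycle of length `k + 1`: distinct vertices `v 0, …, v k` and distinct edges
`e 0, …, e k`, where `e i` joins `v i` and `v (i + 1)`, indices being taken modulo `k + 1`.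
Loops are cycles of length one and pairs of parallel edges are cycles of length two. -/
def HasCycleOfLength (G : Graph α β) (k : ℕ) : Prop :=
  ∃ (v : Fin (k + 1) → α) (e : Fin (k + 1) → β),
    Function.Injective v ∧ Function.Injective e ∧ ∀ i, G.IsLink (e i) (v i) (v (i + 1))

/-- A tree is a connected graph without cycles. -/
def IsTreeGraph (G : Graph α β) : Prop :=
  G.IsConnectedGraph ∧ ∀ k : ℕ, ¬ G.HasCycleOfLength k

/-- A graph is `m`-tree-connected if it has `m` pairwise edge-disjoint spanning trees. -/
def IsTreeConnected (m : ℕ) (G : Graph α β) : Prop :=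
  ∃ T : Fin m → Graph α β,
    (∀ i, T i ≤s G ∧ (T i).IsTreeGraph) ∧
      Pairwise fun i j => Disjoint E(T i) E(T j)

/-- A graph is `t`-tough if `ω(G ∖ S) ≤ max {1, |S| / t}` for every set `S` of vertices. -/
def IsTough (t : ℝ) (G : Graph α β) : Prop :=
  ∀ S ⊆ V(G), ((G.deleteVerts S).numComponents : ℝ) ≤ max 1 (1 / t * (S.ncard : ℝ))

end Graph

namespace TreeFactor

open Finset

/-! ### Partition-connectivity -/

section Surplus

variable {V κ κ' : Type*}

lemma exists_self_coloring (c : V → κ) : ∃ d : V → V, ∀ x y, c x = c y ↔ d x = d y := by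
  have hinv : ∀ x, c (@Function.invFun V κ ⟨x⟩ c (c x)) = c x := fun x =>
    @Function.invFun_eq V κ ⟨x⟩ c (c x) ⟨x, rfl⟩
  exact ⟨fun x => @Function.invFun V κ ⟨x⟩ c (c x), fun x y =>
    ⟨fun h => by simp only [h], fun h => (hinv x).symm.trans ((congrArg c h).trans (hinv y))⟩⟩

variable [DecidableEq κ] [DecidableEq κ'] {m : ℕ} {E E₁ E₂ : Finset (Sym2 V)}
  {X B B₁ B₂ : Finset V} {c : V → κ} {d : V → κ'}

lemma card_image_le_card_image (h : ∀ x ∈ X, ∀ y ∈ X, d x = d y → c x = c y) :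
    #(X.image c) ≤ #(X.image d) := by
  refine card_le_card_of_forall_subsingleton (fun a b => ∃ x ∈ X, c x = a ∧ d x = b) ?_ ?_
  · rintro a ha
    obtain ⟨x, hx, rfl⟩ := mem_image.1 ha
    exact ⟨d x, mem_image_of_mem d hx, x, hx, rfl, rfl⟩
  · rintro b - _ ⟨-, x, hx, rfl, hxb⟩ _ ⟨-, y, hy, rfl, hyb⟩
    exact h x hx y hy (hxb.trans hyb.symm)

lemma card_image_eq_sum_of_refines (h : ∀ x ∈ X, ∀ y ∈ X, d x = d y → c x = c y) :
    #(X.image d) = ∑ a ∈ X.image c, #({x ∈ X | c x = a}.image d) := by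
  rw [← card_biUnion]
  · congr 1
    ext k
    simp only [mem_image, mem_biUnion, mem_filter]
    exact ⟨fun ⟨x, hx, hk⟩ => ⟨c x, ⟨x, hx, rfl⟩, x, ⟨hx, rfl⟩, hk⟩,
      fun ⟨_, _, x, hx, hk⟩ => ⟨x, hx.1, hk⟩⟩
  · intro a _ b _ hab
    simp only [Function.onFun, disjoint_left, mem_image, mem_filter]
    rintro _ ⟨x, ⟨hx, rfl⟩, rfl⟩ ⟨y, ⟨hy, rfl⟩, hxy⟩
    exact hab (h x hx y hy hxy.symm)

variable [DecidableEq V]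

/-- The edges of `E` inside `X` that run between different classes of the partition of `X` into
the colour classes of `c`. Partitions are encoded as colourings throughout. -/
def crossEdges (E : Finset (Sym2 V)) (X : Finset V) (c : V → κ) : Finset (Sym2 V) :=
  {e ∈ E | e ∈ X.sym2 ∧ ¬ (e.map c).IsDiag}

@[simp] lemma mk_mem_crossEdges {x y : V} :
    s(x, y) ∈ crossEdges E X c ↔ s(x, y) ∈ E ∧ (x ∈ X ∧ y ∈ X) ∧ c x ≠ c y := by
  simp [crossEdges]

lemma crossEdges_subset : crossEdges E X c ⊆ E := filter_subset _ _

lemma crossEdges_subset_crossEdges (h : ∀ x ∈ X, ∀ y ∈ X, d x = d y → c x = c y) :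
    crossEdges E X c ⊆ crossEdges E X d := by
  rintro ⟨x, y⟩
  simp only [mk_mem_crossEdges]
  exact fun ⟨he, hxy, hne⟩ => ⟨he, hxy, fun hd => hne (h x hxy.1 y hxy.2 hd)⟩

/-- `m` times the number of colours of `c` on `X`, minus the number of edges of `E` in `X` between
different colours. Partition-connectivity says that this never exceeds `m`. -/
def surplus (m : ℕ) (E : Finset (Sym2 V)) (X : Finset V) (c : V → κ) : ℤ :=
  m * #(X.image c) - #(crossEdges E X c)

lemma surplus_congr (h : ∀ x ∈ X, ∀ y ∈ X, c x = c y ↔ d x = d y) :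
    surplus m E X c = surplus m E X d := by
  rw [surplus, surplus,
    (card_image_le_card_image fun x hx y hy => (h x hx y hy).2).antisymm
      (card_image_le_card_image fun x hx y hy => (h x hx y hy).1),
    (crossEdges_subset_crossEdges fun x hx y hy => (h x hx y hy).2).antisymm
      (crossEdges_subset_crossEdges fun x hx y hy => (h x hx y hy).1)]

lemma surplus_le_of_forall {k : ℤ} (h : ∀ d : V → V, surplus m E X d ≤ k) (c : V → κ) :
    surplus m E X c ≤ k := by
  obtain ⟨d, hd⟩ := exists_self_coloring c
  exact (surplus_congr fun x _ y _ => hd x y).trans_le (h d)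

lemma surplus_of_const (hX : X.Nonempty) (h : ∀ x ∈ X, ∀ y ∈ X, c x = c y) :
    surplus m E X c = m := by
  obtain ⟨a, ha⟩ := hX
  have himage : X.image c = {c a} :=
    eq_singleton_iff_unique_mem.2 ⟨mem_image_of_mem c ha, by simpa using fun x hx => h x hx a ha⟩
  have hcross : crossEdges E X c = ∅ := by
    refine eq_empty_of_forall_notMem ?_
    rintro ⟨x, y⟩
    simp only [mk_mem_crossEdges]
    exact fun ⟨_, hxy, hne⟩ => hne (h x hxy.1 y hxy.2)
  simp [surplus, himage, hcross]

lemma surplus_le_surplus_of_crossEdges_subset (h : crossEdges E₂ X c ⊆ E₁) :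
    surplus m E₁ X c ≤ surplus m E₂ X c := by
  have : #(crossEdges E₂ X c) ≤ #(crossEdges E₁ X c) :=
    card_le_card fun e he => mem_filter.2 ⟨h he, (mem_filter.1 he).2⟩
  unfold surplus
  omega

lemma surplus_anti_right (hBX : B ⊆ X) (himage : X.image c = B.image c) :
    surplus m E X c ≤ surplus m E B c := by
  have : #(crossEdges E B c) ≤ #(crossEdges E X c) :=
    card_le_card fun e he =>
      mem_filter.2 ((mem_filter.1 he).imp_right (And.imp_left (sym2_mono hBX ·)))
  rw [surplus, surplus, himage]
  omega

lemma card_crossEdges_eq_sum_of_refines (h : ∀ x ∈ X, ∀ y ∈ X, d x = d y → c x = c y) :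
    #(crossEdges E X d) =
      #(crossEdges E X c) + ∑ a ∈ X.image c, #(crossEdges E {x ∈ X | c x = a} d) := by
  have hunion : crossEdges E X d = crossEdges E X c ∪
      (X.image c).biUnion fun a => crossEdges E {x ∈ X | c x = a} d := by
    ext ⟨x, y⟩
    simp only [mem_union, mem_biUnion, mk_mem_crossEdges, mem_filter, mem_image]
    grind
  rw [hunion, card_union_of_disjoint, card_biUnion]
  · intro a _ b _ hab
    rw [Function.onFun, disjoint_left]
    rintro ⟨x, y⟩
    simp only [mk_mem_crossEdges, mem_filter]
    exact fun hx hy => hab (hx.2.1.1.2.symm.trans hy.2.1.1.2)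
  · rw [disjoint_left]
    rintro ⟨x, y⟩
    simp only [mem_biUnion, mk_mem_crossEdges, mem_filter]
    exact fun hx ⟨_, _, hy⟩ => hx.2.2 (hy.2.1.1.2.trans hy.2.1.2.2.symm)

theorem surplus_eq_add_sum_of_refines (h : ∀ x ∈ X, ∀ y ∈ X, d x = d y → c x = c y) :
    surplus m E X d =
      surplus m E X c + ∑ a ∈ X.image c, (surplus m E {x ∈ X | c x = a} d - m) := by
  simp only [surplus, card_image_eq_sum_of_refines h, card_crossEdges_eq_sum_of_refines h,
    sum_sub_distrib, sum_const, nsmul_eq_mul, ← mul_sum]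
  push_cast
  ring

/-- `X` is `m`-partition-connected in the graph with edge set `E`: every partition of `X` into `k`
classes has at least `m * (k - 1)` edges of `E` between its classes. By the theorem of
Nash-Williams and Tutte this amounts to `m` edge-disjoint spanning trees on `X`. Only colourings
with values in `V` are tested, see `IsPartitionConnected.surplus_le` for all others. -/
def IsPartitionConnected (m : ℕ) (E : Finset (Sym2 V)) (X : Finset V) : Prop :=
  ∀ c : V → V, surplus m E X c ≤ m

lemma IsPartitionConnected.surplus_le (h : IsPartitionConnected m E X) (c : V → κ) :
    surplus m E X c ≤ m :=
  surplus_le_of_forall h c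

lemma isPartitionConnected_singleton (m : ℕ) (E : Finset (Sym2 V)) (v : V) :
    IsPartitionConnected m E {v} := fun _ =>
  (surplus_of_const (singleton_nonempty v) (by simp)).le

lemma isPartitionConnected_class_of_optimal
    (hopt : ∀ d : V → V, surplus m E X d ≤ surplus m E X c) {b : V} (hb : b ∈ X) :
    IsPartitionConnected m E {x ∈ X | c x = c b} := by
  intro d
  set f : V → κ × Option V := fun v => (c v, if c v = c b then some (d v) else none) with hf
  have hsum := surplus_eq_add_sum_of_refines (m := m) (E := E) (X := X) (c := c) (d := f)
    fun x _ y _ hxy => congrArg Prod.fst hxy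
  rw [sum_eq_single_of_mem (c b) (mem_image_of_mem c hb)] at hsum
  · have hclass : surplus m E {x ∈ X | c x = c b} f = surplus m E {x ∈ X | c x = c b} d :=
      surplus_congr fun x hx y hy => by
        simp [hf, (mem_filter.1 hx).2, (mem_filter.1 hy).2]
    linarith [surplus_le_of_forall hopt f]
  · intro a ha hab
    obtain ⟨x, hx, rfl⟩ := mem_image.1 ha
    rw [surplus_of_const ⟨x, by simp [hx]⟩, sub_self]
    intro y hy z hz
    simp [hf, (mem_filter.1 hy).2, (mem_filter.1 hz).2, hab]

lemma IsPartitionConnected.exists_merge (hB : IsPartitionConnected m E B) (hBX : B ⊆ X)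
    (hne : ∃ x ∈ B, ∃ y ∈ B, c x ≠ c y) :
    ∃ d : V → Option κ, surplus m E X c ≤ surplus m E X d ∧ #(X.image d) < #(X.image c) := by
  set d : V → Option κ := fun v => if c v ∈ B.image c then none else some (c v) with hd
  have href : ∀ x ∈ X, ∀ y ∈ X, c x = c y → d x = d y := fun x _ y _ h => by simp only [hd, h]
  refine ⟨d, ?_, ?_⟩
  · rw [surplus_eq_add_sum_of_refines href, add_le_iff_nonpos_right]
    refine sum_nonpos fun a ha => sub_nonpos.2 ?_
    cases a with
    | none =>
      have hBsub : B ⊆ {x ∈ X | d x = none} := fun x hx =>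
        mem_filter.2 ⟨hBX hx, if_pos (mem_image_of_mem c hx)⟩
      refine (surplus_anti_right hBsub ((image_subset_iff.2 fun x hx => ?_).antisymm
        (image_subset_image hBsub))).trans (hB.surplus_le c)
      by_contra hxB
      exact Option.some_ne_none (c x) ((if_neg hxB).symm.trans (mem_filter.1 hx).2)
    | some k =>
      obtain ⟨x, hx, hxk⟩ := mem_image.1 ha
      refine (surplus_of_const ⟨x, by simp [hx, hxk]⟩ ?_).le
      grind
  · obtain ⟨x, hx, y, hy, hxy⟩ := hne
    refine (card_image_le_card_image href).lt_of_ne fun heq => hxy ?_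
    obtain ⟨g, hg⟩ : ∃ g : κ → Option κ, d = g ∘ c :=
      ⟨fun k => if k ∈ B.image c then none else some k, rfl⟩
    have hinj : Set.InjOn g (X.image c) := card_image_iff.1 (by rw [image_image, ← hg, heq])
    refine hinj (by simpa using ⟨x, hBX hx, rfl⟩) (by simpa using ⟨y, hBX hy, rfl⟩) ?_
    have hnone : ∀ z ∈ B, g (c z) = none := fun z hz =>
      (congrFun hg z).symm.trans (if_pos (mem_image_of_mem c hz))
    rw [hnone x hx, hnone y hy]

theorem exists_coarse_coloring (m : ℕ) (E : Finset (Sym2 V)) (X : Finset V) (c : V → V) :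
    ∃ d : V → V, surplus m E X c ≤ surplus m E X d ∧
      ∀ B ⊆ X, IsPartitionConnected m E B → ∀ x ∈ B, ∀ y ∈ B, d x = d y := by
  induction hn : #(X.image c) using Nat.strong_induction_on generalizing c with
  | _ n ih =>
    by_cases hc : ∀ B ⊆ X, IsPartitionConnected m E B → ∀ x ∈ B, ∀ y ∈ B, c x = c y
    · exact ⟨c, le_rfl, hc⟩
    push Not at hc
    obtain ⟨B, hBX, hB, hne⟩ := hc
    obtain ⟨d, hle, hlt⟩ := hB.exists_merge hBX hne
    obtain ⟨d', hd'⟩ := exists_self_coloring d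
    obtain ⟨f, hf, hconst⟩ := ih _ (hn ▸ (card_image_le_card_image fun x _ y _ =>
      (hd' x y).1).trans_lt hlt) d' rfl
    exact ⟨f, hle.trans ((surplus_congr fun x _ y _ => hd' x y).trans_le hf), hconst⟩

lemma exists_coarse_witness (hX : ¬ IsPartitionConnected m E X) :
    ∃ c : V → V, m < surplus m E X c ∧
      ∀ B ⊆ X, IsPartitionConnected m E B → ∀ x ∈ B, ∀ y ∈ B, c x = c y := by
  obtain ⟨c, hc⟩ := not_forall.1 hX
  obtain ⟨d, hle, hconst⟩ := exists_coarse_coloring m E X c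
  exact ⟨d, (not_le.1 hc).trans_le hle, hconst⟩

lemma exists_surplus_le_of_spanned (h : ∀ e ∈ E₂, e ∈ X.sym2 → e ∈ E₁ ∨
      ∃ B ⊆ X, IsPartitionConnected m E₁ B ∧ e ∈ B.sym2) (c : V → V) :
    ∃ d : V → V, surplus m E₁ X c ≤ surplus m E₂ X d := by
  obtain ⟨d, hle, hconst⟩ := exists_coarse_coloring m E₁ X c
  refine ⟨d, hle.trans (surplus_le_surplus_of_crossEdges_subset ?_)⟩
  rintro ⟨x, y⟩ he
  obtain ⟨he, hxy, hne⟩ := mk_mem_crossEdges.1 he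
  obtain h | ⟨B, hBX, hB, hB'⟩ := h _ he (mk_mem_sym2_iff.2 hxy)
  · exact h
  · exact absurd (hconst B hBX hB x (mk_mem_sym2_iff.1 hB').1 y (mk_mem_sym2_iff.1 hB').2) hne

lemma IsPartitionConnected.of_spanned (hX : IsPartitionConnected m E₂ X)
    (h : ∀ e ∈ E₂, e ∈ X.sym2 → e ∈ E₁ ∨
      ∃ B ⊆ X, IsPartitionConnected m E₁ B ∧ e ∈ B.sym2) :
    IsPartitionConnected m E₁ X := fun c =>
  let ⟨d, hd⟩ := exists_surplus_le_of_spanned h c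
  hd.trans (hX d)

lemma IsPartitionConnected.of_inter_subset (hX : IsPartitionConnected m E₂ X)
    (h : ∀ e ∈ E₂, e ∈ X.sym2 → e ∈ E₁) : IsPartitionConnected m E₁ X :=
  hX.of_spanned fun e he heX => Or.inl (h e he heX)

lemma IsPartitionConnected.union (h₁ : IsPartitionConnected m E B₁)
    (h₂ : IsPartitionConnected m E B₂) (h : (B₁ ∩ B₂).Nonempty) :
    IsPartitionConnected m E (B₁ ∪ B₂) := by
  intro c
  obtain ⟨d, hle, hconst⟩ := exists_coarse_coloring m E (B₁ ∪ B₂) c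
  obtain ⟨b, hb⟩ := h
  rw [mem_inter] at hb
  have hdb : ∀ x ∈ B₁ ∪ B₂, d x = d b := fun x hx => (mem_union.1 hx).elim
    (fun hx => hconst B₁ subset_union_left h₁ x hx b hb.1)
    (fun hx => hconst B₂ subset_union_right h₂ x hx b hb.2)
  exact hle.trans (surplus_of_const ⟨b, mem_union_left _ hb.1⟩ fun x hx y hy =>
    (hdb x hx).trans (hdb y hy).symm).le

lemma IsPartitionConnected.exchange {D : Finset V} {x y : V} (hD : IsPartitionConnected m E D)
    (hx : x ∈ D) (hy : y ∈ D) (he : s(x, y) ∉ E)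
    (hmin : ∀ D' ⊂ D, x ∈ D' → y ∈ D' → ¬ IsPartitionConnected m E D') {f : Sym2 V}
    (hf : f ∈ D.sym2) : IsPartitionConnected m (insert s(x, y) (E.erase f)) D := by
  intro c
  by_contra! hlt
  have hDc := hD c
  have hcard : #(crossEdges (insert s(x, y) (E.erase f)) D c) < #(crossEdges E D c) := by
    unfold surplus at hlt hDc
    omega
  have hsub : (crossEdges E D c).erase f ⊆ crossEdges (insert s(x, y) (E.erase f)) D c := by
    intro e
    simp only [crossEdges, mem_erase, mem_filter, mem_insert]
    tauto
  have hfc : f ∈ crossEdges E D c := by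
    by_contra hfc
    rw [erase_eq_of_notMem hfc] at hsub
    exact (card_le_card hsub).not_gt hcard
  have hxy : c x = c y := by
    by_contra hne
    have hsub' : insert s(x, y) ((crossEdges E D c).erase f) ⊆
        crossEdges (insert s(x, y) (E.erase f)) D c :=
      insert_subset (by simp [hx, hy, hne]) hsub
    have := card_le_card hsub'
    rw [card_insert_of_notMem (by simp [he]), card_erase_add_one hfc] at this
    omega
  have hopt : ∀ d : V → V, surplus m E D d ≤ surplus m E D c := by
    intro d
    have hcard' := card_le_card hsub
    rw [card_erase_of_mem hfc] at hcard'
    have hDd := hD d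
    unfold surplus at hlt hDd ⊢
    omega
  refine hmin {v ∈ D | c v = c x} ⟨filter_subset _ _, fun hall => ?_⟩ (by simp [hx])
    (by simp [hy, hxy]) (isPartitionConnected_class_of_optimal hopt hx)
  induction f with | _ a b
  have hconst : ∀ v ∈ D, c v = c x := fun v hv => (mem_filter.1 (hall hv)).2
  obtain ⟨-, ⟨ha, hb⟩, hab⟩ := mk_mem_crossEdges.1 hfc
  exact hab ((hconst a ha).trans (hconst b hb).symm)

end Surplus

section MaxSurplus

variable {V : Type*} [DecidableEq V] [Fintype V] {m : ℕ} {E E₁ E₂ : Finset (Sym2 V)}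

/-- The largest surplus of a partition of the whole vertex set; it measures how far `E` is from
being `m`-partition-connected. -/
def maxSurplus (m : ℕ) (E : Finset (Sym2 V)) : ℤ :=
  (univ : Finset (V → V)).sup' ⟨id, mem_univ _⟩ (surplus m E univ)

lemma surplus_le_maxSurplus (c : V → V) : surplus m E univ c ≤ maxSurplus m E :=
  le_sup' (surplus m E univ) (mem_univ c)

lemma exists_surplus_eq_maxSurplus (m : ℕ) (E : Finset (Sym2 V)) :
    ∃ c : V → V, surplus m E univ c = maxSurplus m E :=
  let ⟨c, _, hc⟩ := exists_mem_eq_sup' ⟨id, mem_univ _⟩ (surplus m E univ)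
  ⟨c, hc.symm⟩

lemma maxSurplus_le_of_spanned (h : ∀ e ∈ E₂, e ∈ E₁ ∨
    ∃ B, IsPartitionConnected m E₁ B ∧ e ∈ B.sym2) : maxSurplus m E₁ ≤ maxSurplus m E₂ := by
  obtain ⟨c, hc⟩ := exists_surplus_eq_maxSurplus m E₁
  obtain ⟨d, hd⟩ := exists_surplus_le_of_spanned (X := univ)
    (fun e he _ => (h e he).imp_right fun ⟨B, hB⟩ => ⟨B, subset_univ B, hB⟩) c
  exact hc.symm.le.trans (hd.trans (surplus_le_maxSurplus d))

lemma exists_isPartitionConnected_of_maxSurplus_le {x y : V} (he : s(x, y) ∉ E)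
    (h : maxSurplus m E ≤ maxSurplus m (insert s(x, y) E)) :
    ∃ D, x ∈ D ∧ y ∈ D ∧ IsPartitionConnected m E D := by
  obtain ⟨c, hc⟩ := exists_surplus_eq_maxSurplus m (insert s(x, y) E)
  have hsub : crossEdges E univ c ⊆ crossEdges (insert s(x, y) E) univ c :=
    filter_subset_filter _ (subset_insert _ _)
  have hle := surplus_le_maxSurplus (m := m) (E := E) c
  have hcard : #(crossEdges (insert s(x, y) E) univ c) ≤ #(crossEdges E univ c) := by
    unfold surplus at hc hle
    omega
  have hxy : c x = c y := by
    by_contra hne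
    have hmem : s(x, y) ∈ crossEdges (insert s(x, y) E) univ c := by simp [hne]
    exact he (crossEdges_subset (eq_of_subset_of_card_le hsub hcard ▸ hmem))
  refine ⟨({v | c v = c x} : Finset V), by simp, by simp [hxy],
    isPartitionConnected_class_of_optimal (fun d => ?_) (mem_univ x)⟩
  calc surplus m E univ d ≤ maxSurplus m (insert s(x, y) E) := (surplus_le_maxSurplus d).trans h
    _ = surplus m (insert s(x, y) E) univ c := hc.symm
    _ ≤ surplus m E univ c :=
      surplus_le_surplus_of_crossEdges_subset (crossEdges_subset.trans (subset_insert _ _))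

theorem exists_exchange_set_of_maxSurplus_le {x y : V} (he : s(x, y) ∉ E)
    (h : maxSurplus m E ≤ maxSurplus m (insert s(x, y) E)) :
    ∃ D, x ∈ D ∧ y ∈ D ∧ IsPartitionConnected m E D ∧
      ∀ f ∈ D.sym2, IsPartitionConnected m (insert s(x, y) (E.erase f)) D := by
  obtain ⟨D, ⟨hxD, hyD, hD⟩, hmin⟩ :=
    WellFounded.has_min (wellFounded_lt (α := Finset V))
      {D | x ∈ D ∧ y ∈ D ∧ IsPartitionConnected m E D}
      (exists_isPartitionConnected_of_maxSurplus_le he h)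
  exact ⟨D, hxD, hyD, hD, fun f hf => hD.exchange hxD hyD he
    (fun D' hlt hx hy hD' => hmin D' ⟨hx, hy, hD'⟩ hlt) hf⟩

end MaxSurplus

/-! ### Augmentation by edges under degree capacities -/

section EdgeDegree

variable {V : Type*} [DecidableEq V] {M M' : Finset (Sym2 V)} {f : Sym2 V} {v : V}

/-- The number of edges of `M` at the vertex `v`. -/
def edgeDegree (M : Finset (Sym2 V)) (v : V) : ℕ := #{e ∈ M | v ∈ e}

lemma edgeDegree_congr (h : ∀ e, v ∈ e → (e ∈ M ↔ e ∈ M')) : edgeDegree M v = edgeDegree M' v := by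
  rw [edgeDegree, edgeDegree]
  congr 1
  ext e
  simp only [mem_filter]
  exact and_congr_left (h e)

lemma edgeDegree_mono (h : M ⊆ M') (v : V) : edgeDegree M v ≤ edgeDegree M' v :=
  card_le_card (filter_subset_filter _ h)

lemma edgeDegree_erase (hf : f ∈ M) (hv : v ∈ f) :
    edgeDegree (M.erase f) v + 1 = edgeDegree M v := by
  rw [edgeDegree, edgeDegree, filter_erase]
  exact card_erase_add_one (mem_filter.2 ⟨hf, hv⟩)

lemma edgeDegree_insert (hf : f ∉ M) (v : V) :
    edgeDegree (insert f M) v = edgeDegree M v + if v ∈ f then 1 else 0 := by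
  rw [edgeDegree, edgeDegree, filter_insert]
  split_ifs with h
  · rw [card_insert_of_notMem (by simp [hf])]
  · rfl

lemma edgeDegree_pos (hf : f ∈ M) (hv : v ∈ f) : 0 < edgeDegree M v :=
  card_pos.2 ⟨f, mem_filter.2 ⟨hf, hv⟩⟩

end EdgeDegree

/-- The data of the local search: to the fixed graph with edge set `base` we want to add some of the
edges of `extra`, at most `capacity v` of them at each vertex `v`, so as to make it
`m`-partition-connected. -/
structure AugmentationProblem (V : Type*) where
  m : ℕ
  base : Finset (Sym2 V)
  extra : Finset (Sym2 V)
  capacity : V → ℕ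
  not_isDiag : ∀ e ∈ extra, ¬ e.IsDiag
  disjoint : Disjoint extra base

namespace AugmentationProblem

variable {V : Type*} [DecidableEq V] {P : AugmentationProblem V} {M M' N : Finset (Sym2 V)}
  {B B' D X : Finset V} {x y : V}

/-- `M` is a set of extra edges that respects the capacities. -/
def IsAdmissible (P : AugmentationProblem V) (M : Finset (Sym2 V)) : Prop :=
  M ⊆ P.extra ∧ ∀ v, edgeDegree M v ≤ P.capacity v

lemma IsAdmissible.subset (hM : P.IsAdmissible M) (h : N ⊆ M) : P.IsAdmissible N :=
  ⟨h.trans hM.1, fun v => (edgeDegree_mono h v).trans (hM.2 v)⟩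

lemma IsAdmissible.edgeDegree_erase_lt (hM : P.IsAdmissible M) {f : Sym2 V} (hf : f ∈ M)
    (hx : x ∈ f) : edgeDegree (M.erase f) x < P.capacity x := by
  have := edgeDegree_erase hf hx
  have := hM.2 x
  omega

lemma IsAdmissible.insert (hM : P.IsAdmissible M) (he : s(x, y) ∈ P.extra) (heM : s(x, y) ∉ M)
    (hx : edgeDegree M x < P.capacity x) (hy : edgeDegree M y < P.capacity y) :
    P.IsAdmissible (insert s(x, y) M) := by
  refine ⟨insert_subset he hM.1, fun v => ?_⟩
  rw [edgeDegree_insert heM]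
  split_ifs with hv
  · rcases Sym2.mem_iff.1 hv with rfl | rfl
    · exact hx
    · exact hy
  · exact hM.2 v

/-- Adding the edges of `M` to the base graph makes the set `X` partition-connected. -/
def Connects (P : AugmentationProblem V) (M : Finset (Sym2 V)) (X : Finset V) : Prop :=
  IsPartitionConnected P.m (P.base ∪ M) X

lemma Connects.of_inter_subset (hX : P.Connects M X) (h : ∀ e ∈ M, e ∈ X.sym2 → e ∈ N) :
    P.Connects N X :=
  IsPartitionConnected.of_inter_subset hX fun e he heX =>
    mem_union.2 ((mem_union.1 he).imp_right fun he => h e he heX)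

lemma Connects.of_spanned (hX : P.Connects M X)
    (h : ∀ e ∈ M, e ∈ X.sym2 → e ∈ N ∨ ∃ B ⊆ X, P.Connects N B ∧ e ∈ B.sym2) :
    P.Connects N X :=
  IsPartitionConnected.of_spanned hX fun e he heX => (mem_union.1 he).elim
    (fun he => Or.inl (mem_union_left _ he)) fun he => (h e he heX).imp_left (mem_union_right _)

lemma Connects.union (h₁ : P.Connects M B) (h₂ : P.Connects M B') (h : (B ∩ B').Nonempty) :
    P.Connects M (B ∪ B') :=
  IsPartitionConnected.union h₁ h₂ h

lemma Connects.of_agree (hX : P.Connects N X) (hBX : B ⊆ X) (hB : P.Connects M B) (hB'X : B' ⊆ X)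
    (hB' : P.Connects M B') (h : ∀ e ∉ B.sym2, e ∉ B'.sym2 → e ∈ N → e ∈ M) : P.Connects M X := by
  refine hX.of_spanned fun e he _ => ?_
  by_cases heB : e ∈ B.sym2
  · exact Or.inr ⟨B, hBX, hB, heB⟩
  by_cases heB' : e ∈ B'.sym2
  · exact Or.inr ⟨B', hB'X, hB', heB'⟩
  exact Or.inl (h e heB heB' he)

/-- By changing `M` inside `D` only, and keeping `D` partition-connected, the vertex `x` can be
brought below its capacity. -/
def CanFree (P : AugmentationProblem V) (M : Finset (Sym2 V)) (D : Finset V) (x : V) : Prop :=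
  ∃ M', P.IsAdmissible M' ∧ (∀ e ∉ D.sym2, e ∈ M' ↔ e ∈ M) ∧ P.Connects M' D ∧
    edgeDegree M' x < P.capacity x

lemma CanFree.mono (h : P.CanFree M B x) (hBD : B ⊆ D) (hD : P.Connects M D) :
    P.CanFree M D x := by
  obtain ⟨M', hM', hagree, hB, hx⟩ := h
  exact ⟨M', hM', fun e he => hagree e fun h => he (sym2_mono hBD h),
    hD.of_agree hBD hB hBD hB fun e heB _ => (hagree e heB).2, hx⟩

lemma canFree_of_connects_erase (hM : P.IsAdmissible M) {f : Sym2 V} (hf : f ∈ M)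
    (hfD : f ∈ D.sym2) (hD : P.Connects (M.erase f) D) (hx : x ∈ f) : P.CanFree M D x := by
  refine ⟨M.erase f, hM.subset (erase_subset _ _), fun e he => ?_, hD,
    hM.edgeDegree_erase_lt hf hx⟩
  exact mem_erase.trans (and_iff_right fun h => he (h ▸ hfD))

lemma CanFree.exists_join (h : P.CanFree M B x) (h' : P.CanFree M B' y) (hdisj : Disjoint B B')
    (hx : x ∈ B) (hy : y ∈ B') :
    ∃ N, P.IsAdmissible N ∧ (∀ e ∉ B.sym2, e ∉ B'.sym2 → (e ∈ N ↔ e ∈ M)) ∧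
      P.Connects N B ∧ P.Connects N B' ∧
      edgeDegree N x < P.capacity x ∧ edgeDegree N y < P.capacity y := by
  obtain ⟨M₁, hM₁, hagree₁, hB₁, hx₁⟩ := h
  obtain ⟨M₂, hM₂, hagree₂, hB₂, hy₂⟩ := h'
  set N : Finset (Sym2 V) := {e ∈ M₁ | e ∈ B.sym2} ∪ {e ∈ M₂ | e ∉ B.sym2} with hN
  have hN₂ : ∀ e ∉ B.sym2, e ∈ N ↔ e ∈ M₂ := fun e he => by simp [hN, he]
  have hN₁ : ∀ e ∉ B'.sym2, e ∈ N ↔ e ∈ M₁ := fun e he => by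
    by_cases heB : e ∈ B.sym2
    · simp [hN, heB]
    · rw [hN₂ e heB, hagree₂ e he, hagree₁ e heB]
  have hdeg₁ : ∀ v ∈ B, edgeDegree N v = edgeDegree M₁ v := fun v hv => edgeDegree_congr fun e he =>
    hN₁ e fun h => disjoint_left.1 hdisj hv (mem_sym2_iff.1 h v he)
  have hdeg₂ : ∀ v ∉ B, edgeDegree N v = edgeDegree M₂ v := fun v hv => edgeDegree_congr fun e he =>
    hN₂ e fun h => hv (mem_sym2_iff.1 h v he)
  refine ⟨N, ⟨union_subset ((filter_subset _ _).trans hM₁.1) ((filter_subset _ _).trans hM₂.1),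
    fun v => ?_⟩, fun e he he' => (hN₁ e he').trans (hagree₁ e he), ?_, ?_, ?_, ?_⟩
  · by_cases hv : v ∈ B
    · exact (hdeg₁ v hv).trans_le (hM₁.2 v)
    · exact (hdeg₂ v hv).trans_le (hM₂.2 v)
  · exact hB₁.of_inter_subset fun e he heB => by simp [hN, he, heB]
  · refine hB₂.of_inter_subset fun e he heB' => (hN₂ e ?_).2 he
    induction e with | _ a b
    exact fun heB =>
      disjoint_left.1 hdisj (mk_mem_sym2_iff.1 heB).1 (mk_mem_sym2_iff.1 heB').1
  · rwa [hdeg₁ x hx]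
  · rwa [hdeg₂ y (disjoint_right.1 hdisj hy)]

/-- A partition-connected set within which every edge of `M` can be freed at both of its ends. -/
def IsFlexible (P : AugmentationProblem V) (M : Finset (Sym2 V)) (D : Finset V) : Prop :=
  D.Nonempty ∧ P.Connects M D ∧ ∀ f ∈ M, f ∈ D.sym2 → ∀ x ∈ f, P.CanFree M D x

lemma isFlexible_singleton (hM : P.IsAdmissible M) (v : V) : P.IsFlexible M {v} := by
  refine ⟨singleton_nonempty v, isPartitionConnected_singleton _ _ _, fun f hf hfv => ?_⟩
  refine absurd ?_ (P.not_isDiag f (hM.1 hf))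
  induction f with | _ a b
  rw [mk_mem_sym2_iff, mem_singleton, mem_singleton] at hfv
  exact Sym2.mk_isDiag_iff.2 (hfv.1.trans hfv.2.symm)

lemma IsFlexible.union (hM : P.IsAdmissible M) (h : P.IsFlexible M B) (h' : P.IsFlexible M B')
    (hne : (B ∩ B').Nonempty) : P.IsFlexible M (B ∪ B') := by
  have hconn := h.2.1.union h'.2.1 hne
  refine ⟨h.1.mono subset_union_left, hconn, fun f hf hfU x hx => ?_⟩
  by_cases hfB : f ∈ B.sym2
  · exact (h.2.2 f hf hfB x hx).mono subset_union_left hconn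
  by_cases hfB' : f ∈ B'.sym2
  · exact (h'.2.2 f hf hfB' x hx).mono subset_union_right hconn
  refine canFree_of_connects_erase hM hf hfU (Connects.union ?_ ?_ hne) hx
  · exact h.2.1.of_inter_subset fun e he heB => mem_erase.2 ⟨fun hef => hfB (hef ▸ heB), he⟩
  · exact h'.2.1.of_inter_subset fun e he heB => mem_erase.2 ⟨fun hef => hfB' (hef ▸ heB), he⟩

lemma isFlexible_of_exchange (hB : P.IsFlexible M B) (hB' : P.IsFlexible M B')
    (hNB : P.Connects N B) (hNB' : P.Connects N B')
    (hagree : ∀ e ∉ B.sym2, e ∉ B'.sym2 → (e ∈ N ↔ e ∈ M)) (hxB : x ∈ B) (hyB' : y ∈ B')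
    (hadd : P.IsAdmissible (insert s(x, y) N)) (he : s(x, y) ∉ N)
    (hxD : x ∈ D) (hyD : y ∈ D) (hD : P.Connects N D)
    (hexch : ∀ f ∈ D.sym2, P.Connects (insert s(x, y) (N.erase f)) D) :
    P.IsFlexible M (D ∪ B ∪ B') := by
  have hunion : ∀ K, P.Connects K D → P.Connects K B → P.Connects K B' →
      P.Connects K (D ∪ B ∪ B') := fun K h₁ h₂ h₃ =>
    (h₁.union h₂ ⟨x, by simp [hxD, hxB]⟩).union h₃ ⟨y, by simp [hyD, hyB']⟩
  have hBU : B ⊆ D ∪ B ∪ B' := subset_union_right.trans subset_union_left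
  have hB'U : B' ⊆ D ∪ B ∪ B' := subset_union_right
  have hU : P.Connects M (D ∪ B ∪ B') := (hunion N hD hNB hNB').of_agree hBU hB.2.1 hB'U hB'.2.1
    fun e heB heB' => (hagree e heB heB').1
  refine ⟨⟨x, hBU hxB⟩, hU, fun f hf hfU v hv => ?_⟩
  by_cases hfB : f ∈ B.sym2
  · exact (hB.2.2 f hf hfB v hv).mono hBU hU
  by_cases hfB' : f ∈ B'.sym2
  · exact (hB'.2.2 f hf hfB' v hv).mono hB'U hU
  have hfN : f ∈ N := (hagree f hfB hfB').2 hf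
  have hkeep : ∀ C : Finset V, f ∉ C.sym2 → P.Connects N C →
      P.Connects (insert s(x, y) (N.erase f)) C := fun C hfC hC =>
    hC.of_inter_subset fun e he heC =>
      mem_insert_of_mem (mem_erase.2 ⟨fun hef => hfC (hef ▸ heC), he⟩)
  have herase : insert s(x, y) (N.erase f) = (insert s(x, y) N).erase f :=
    (erase_insert_of_ne fun h : s(x, y) = f => he (h ▸ hfN)).symm
  refine ⟨insert s(x, y) (N.erase f), hadd.subset (insert_subset_insert _ (erase_subset _ _)),
    fun e he => ?_, hunion _ ?_ (hkeep B hfB hNB) (hkeep B' hfB' hNB'),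
    herase ▸ hadd.edgeDegree_erase_lt (mem_insert_of_mem hfN) hv⟩
  · have hexy : e ≠ s(x, y) := by rintro rfl; exact he (by simp [hxD, hyD])
    have hef : e ≠ f := by rintro rfl; exact he hfU
    rw [mem_insert, mem_erase, or_iff_right hexy, and_iff_right hef,
      hagree e (fun h => he (sym2_mono hBU h)) fun h => he (sym2_mono hB'U h)]
  · by_cases hfD : f ∈ D.sym2
    · exact hexch f hfD
    · exact hkeep D hfD hD

variable [Fintype V]

open Classical in
/-- The largest flexible set containing `x`. -/
noncomputable def part (P : AugmentationProblem V) (M : Finset (Sym2 V)) (x : V) : Finset V :=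
  {y | ∃ D, P.IsFlexible M D ∧ x ∈ D ∧ y ∈ D}

lemma mem_part : y ∈ P.part M x ↔ ∃ D, P.IsFlexible M D ∧ x ∈ D ∧ y ∈ D := by
  simp [part]

lemma IsFlexible.subset_part (h : P.IsFlexible M D) (hx : x ∈ D) : D ⊆ P.part M x :=
  fun _ hy => mem_part.2 ⟨D, h, hx, hy⟩

lemma self_mem_part (hM : P.IsAdmissible M) (x : V) : x ∈ P.part M x :=
  (isFlexible_singleton hM x).subset_part (mem_singleton_self x) (mem_singleton_self x)

lemma isFlexible_part (hM : P.IsAdmissible M) (x : V) : P.IsFlexible M (P.part M x) := by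
  obtain ⟨D, ⟨hD, hxD⟩, hmax⟩ := WellFounded.has_min (wellFounded_gt (α := Finset V))
    {D | P.IsFlexible M D ∧ x ∈ D} ⟨{x}, isFlexible_singleton hM x, mem_singleton_self x⟩
  suffices P.part M x = D by rwa [this]
  refine Subset.antisymm (fun y hy => ?_) (hD.subset_part hxD)
  obtain ⟨D', hD', hxD', hyD'⟩ := mem_part.1 hy
  have hU := hD.union hM hD' ⟨x, mem_inter.2 ⟨hxD, hxD'⟩⟩
  by_contra hyD
  exact hmax (D ∪ D') ⟨hU, mem_union_left _ hxD⟩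
    ⟨subset_union_left, fun hsub => hyD (hsub (mem_union_right _ hyD'))⟩

lemma part_eq_of_mem (hM : P.IsAdmissible M) (h : y ∈ P.part M x) : P.part M y = P.part M x := by
  have hsub := (isFlexible_part hM x).subset_part h
  exact ((isFlexible_part hM y).subset_part (hsub (self_mem_part hM x))).antisymm hsub

/-- `M` is admissible and brings the graph as close as possible to being partition-connected. -/
def IsOptimal (P : AugmentationProblem V) (M : Finset (Sym2 V)) : Prop :=
  P.IsAdmissible M ∧
    ∀ M', P.IsAdmissible M' → maxSurplus P.m (P.base ∪ M) ≤ maxSurplus P.m (P.base ∪ M')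

lemma exists_isOptimal (P : AugmentationProblem V) : ∃ M, P.IsOptimal M := by
  classical
  obtain ⟨M, hM, hopt⟩ := exists_min_image ({M | P.IsAdmissible M} : Finset (Finset (Sym2 V)))
    (fun M => maxSurplus P.m (P.base ∪ M)) ⟨∅, mem_filter.2
      ⟨mem_univ _, empty_subset _, fun v => by simp [edgeDegree]⟩⟩
  exact ⟨M, (mem_filter.1 hM).2, fun M' hM' => hopt M' (by simpa using hM')⟩

/-- Otherwise `s(x, y)` could be added to `M` after freeing `x` and `y`. By optimality this is no
gain, so `x` and `y` lie in a common exchange set, which merges the parts of `x` and `y`. -/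
lemma IsOptimal.mem_part_of_canFree (hM : P.IsOptimal M) (hx : P.CanFree M (P.part M x) x)
    (hy : P.CanFree M (P.part M y) y) (he : s(x, y) ∈ P.extra) (heM : s(x, y) ∉ M) :
    y ∈ P.part M x := by
  by_contra hxy
  have hB := isFlexible_part hM.1 x
  have hB' := isFlexible_part hM.1 y
  have hxB := self_mem_part hM.1 x
  have hyB' := self_mem_part hM.1 y
  have hdisj : Disjoint (P.part M x) (P.part M y) := disjoint_left.2 fun z hz hz' => hxy <| by
    rwa [← part_eq_of_mem hM.1 hz, part_eq_of_mem hM.1 hz']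
  obtain ⟨N, hN, hagree, hNB, hNB', hxN, hyN⟩ := hx.exists_join hy hdisj hxB hyB'
  have heN : s(x, y) ∉ N := by
    rwa [hagree _ (fun h => hxy (mk_mem_sym2_iff.1 h).2)
      fun h => disjoint_left.1 hdisj hxB (mk_mem_sym2_iff.1 h).1]
  have hadd := hN.insert he heN hxN hyN
  have hspan : maxSurplus P.m (P.base ∪ N) ≤ maxSurplus P.m (P.base ∪ M) :=
    maxSurplus_le_of_spanned fun e he => by
      by_cases heB : e ∈ (P.part M x).sym2
      · exact Or.inr ⟨_, hNB, heB⟩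
      by_cases heB' : e ∈ (P.part M y).sym2
      · exact Or.inr ⟨_, hNB', heB'⟩
      exact Or.inl (by simpa [hagree e heB heB'] using he)
  have hopt : maxSurplus P.m (P.base ∪ N) ≤ maxSurplus P.m (insert s(x, y) (P.base ∪ N)) := by
    rw [← union_insert]
    exact hspan.trans (hM.2 _ hadd)
  obtain ⟨D, hxD, hyD, hD, hexch⟩ := exists_exchange_set_of_maxSurplus_le
    (by simp [heN, disjoint_left.1 P.disjoint he]) hopt
  have hU := isFlexible_of_exchange hB hB' hNB hNB' hagree hxB hyB' hadd heN hxD hyD hD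
    fun f hf => (hexch f hf).of_inter_subset fun e he _ => by
      simp only [mem_insert, mem_erase, mem_union] at he ⊢
      tauto
  exact hxy (hU.subset_part (by simp [hxD]) (by simp [hyD]))

lemma exists_coloring_of_not_isFlexible (hM : P.IsAdmissible M) (hX : X.Nonempty)
    (hpart : ∀ x ∈ X, P.part M x ⊆ X) (hflex : ¬ P.IsFlexible M X) :
    ∃ c : V → V, P.m ≤ surplus P.m (P.base ∪ M) X c ∧ (∃ x ∈ X, ∃ y ∈ X, c x ≠ c y) ∧
      ∀ x ∈ X, ∀ y ∈ P.part M x, c y = c x := by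
  have hnonconst : ∀ {E} {c : V → V}, (P.m : ℤ) < surplus P.m E X c →
      ∃ x ∈ X, ∃ y ∈ X, c x ≠ c y := fun hc => by
    by_contra! hconst
    exact hc.ne' (surplus_of_const hX hconst)
  by_cases hconn : P.Connects M X
  · obtain ⟨f, hf, hfX, x, hxf, hx⟩ :
        ∃ f ∈ M, f ∈ X.sym2 ∧ ∃ x ∈ f, ¬ P.CanFree M X x := by
      by_contra! h
      exact hflex ⟨hX, hconn, h⟩
    obtain ⟨c, hc, hconst⟩ := exists_coarse_witness fun hconn' =>
      hx (canFree_of_connects_erase hM hf hfX hconn' hxf)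
    refine ⟨c, ?_, hnonconst hc, fun y hy z hz =>
      hconst _ (hpart y hy) ?_ z hz y (self_mem_part hM y)⟩
    · have hcross : #(crossEdges (P.base ∪ M) X c) ≤
          #(crossEdges (P.base ∪ M.erase f) X c) + 1 := by
        refine (card_le_card fun e he => ?_).trans (card_insert_le f _)
        simp only [crossEdges, mem_insert, mem_filter, mem_union, mem_erase] at he ⊢
        tauto
      unfold surplus at hc ⊢
      omega
    · have hflex' := isFlexible_part hM y
      exact hflex'.2.1.of_inter_subset fun e he heB => mem_erase.2
        ⟨fun hef => hx ((hflex'.2.2 f hf (hef ▸ heB) x hxf).mono (hpart y hy) hconn), he⟩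
  · obtain ⟨c, hc, hconst⟩ := exists_coarse_witness hconn
    exact ⟨c, hc.le, hnonconst hc, fun y hy z hz =>
      hconst _ (hpart y hy) (isFlexible_part hM y).2.1 z hz y (self_mem_part hM y)⟩

theorem le_surplus_part (hM : P.IsAdmissible M) (hX : X.Nonempty)
    (hpart : ∀ x ∈ X, P.part M x ⊆ X) : P.m ≤ surplus P.m (P.base ∪ M) X (P.part M) := by
  induction X using Finset.strongInduction with
  | H X ih =>
    by_cases hflex : P.IsFlexible M X
    · exact (surplus_of_const hX fun x hx y hy =>
        (part_eq_of_mem hM (hflex.subset_part hx hy)).symm).ge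
    obtain ⟨c, hc, ⟨a, ha, a', ha', hne⟩, hconst⟩ :=
      exists_coloring_of_not_isFlexible hM hX hpart hflex
    rw [surplus_eq_add_sum_of_refines (c := c) (d := P.part M) fun x _ y hy hxy =>
      hconst y hy x (hxy ▸ self_mem_part hM x)]
    refine hc.trans (le_add_of_nonneg_right (sum_nonneg fun b hb => sub_nonneg.2 ?_))
    obtain ⟨z, hz, rfl⟩ := mem_image.1 hb
    refine ih _ ⟨filter_subset _ _, fun hsub => ?_⟩ ⟨z, by simp [hz]⟩ fun x hx y hy => ?_
    · exact hne ((mem_filter.1 (hsub ha)).2.trans (mem_filter.1 (hsub ha')).2.symm)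
    · rw [mem_filter] at hx ⊢
      exact ⟨hpart x hx.1 hy, (hconst x hx.1 y hy).trans hx.2⟩

lemma lt_surplus_part (hM : P.IsAdmissible M) (hconn : ¬ P.Connects M univ) :
    P.m < surplus P.m (P.base ∪ M) univ (P.part M) := by
  obtain ⟨c, hc, hconst⟩ := exists_coarse_witness hconn
  have hpart : ∀ x, ∀ y ∈ P.part M x, c y = c x := fun x y hy =>
    hconst _ (subset_univ _) (isFlexible_part hM x).2.1 y hy x (self_mem_part hM x)
  rw [surplus_eq_add_sum_of_refines (c := c) (d := P.part M) fun x _ y _ hxy =>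
    hpart y x (hxy ▸ self_mem_part hM x)]
  refine hc.trans_le (le_add_of_nonneg_right (sum_nonneg fun b hb => sub_nonneg.2 ?_))
  obtain ⟨z, -, rfl⟩ := mem_image.1 hb
  refine le_surplus_part hM ⟨z, by simp⟩ fun x hx y hy => ?_
  exact mem_filter.2 ⟨mem_univ y, (hpart x y hy).trans (mem_filter.1 hx).2⟩

/-- A certificate that `M` cannot be improved: a set `S` of saturated vertices and a partition into
the colour classes of `p`, such that extra edges between different classes meet `S`, and whose
classes are joined by few edges. -/
structure IsBarrier {κ : Type*} [DecidableEq κ] (P : AugmentationProblem V) (M : Finset (Sym2 V))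
    (S : Finset V) (p : V → κ) : Prop where
  saturated : ∀ x ∈ S, edgeDegree M x = P.capacity x
  color_ne : ∀ x ∈ S, ∀ y, s(x, y) ∈ M → p x ≠ p y
  color_eq : ∀ x y, x ∉ S → y ∉ S → s(x, y) ∈ P.extra → p x = p y
  le_surplus : ∀ Q ⊆ univ.image p, Q.Nonempty →
    P.m ≤ surplus P.m (P.base ∪ M) {x | p x ∈ Q} p
  lt_surplus : P.m < surplus P.m (P.base ∪ M) univ p

open Classical in
/-- The barrier consists of the vertices that cannot be freed. -/
lemma IsOptimal.isBarrier (hM : P.IsOptimal M) (hcap : ∀ v, P.capacity v ≤ 1)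
    (hconn : ¬ P.Connects M univ) :
    P.IsBarrier M ({x | ¬ P.CanFree M (P.part M x) x} : Finset V) (P.part M) where
  saturated x hx := by
    rw [mem_filter_univ] at hx
    refine (hM.1.2 x).antisymm (not_lt.1 fun hlt => hx ?_)
    exact ⟨M, hM.1, fun _ _ => Iff.rfl, (isFlexible_part hM.1 x).2.1, hlt⟩
  color_ne x hx y hxy hp := by
    rw [mem_filter_univ] at hx
    refine hx ((isFlexible_part hM.1 x).2.2 _ hxy ?_ x (Sym2.mem_mk_left x y))
    exact mk_mem_sym2_iff.2 ⟨self_mem_part hM.1 x, hp ▸ self_mem_part hM.1 y⟩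
  color_eq x y hx hy hxy := by
    rw [mem_filter_univ, not_not] at hx hy
    suffices h : y ∈ P.part M x from (part_eq_of_mem hM.1 h).symm
    by_cases hxyM : s(x, y) ∈ M
    · by_contra hy'
      obtain ⟨M', -, hagree, -, hlt⟩ := hx
      have hmem := (hagree s(x, y) fun h => hy' (mk_mem_sym2_iff.1 h).2).2 hxyM
      have := edgeDegree_pos hmem (Sym2.mem_mk_left x y)
      have := hcap x
      omega
    · exact hM.mem_part_of_canFree hx hy hxy hxyM
  le_surplus Q hQ hne := by
    obtain ⟨a, ha⟩ := hne
    obtain ⟨z, -, rfl⟩ := mem_image.1 (hQ ha)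
    refine le_surplus_part hM.1 ⟨z, by simpa using ha⟩ fun x hx y hy => ?_
    simpa [part_eq_of_mem hM.1 hy] using hx
  lt_surplus := lt_surplus_part hM.1 hconn

theorem exists_connects_or_isBarrier (P : AugmentationProblem V) (hcap : ∀ v, P.capacity v ≤ 1) :
    ∃ M, P.IsAdmissible M ∧ (P.Connects M univ ∨ ∃ S, ∃ p : V → Finset V, P.IsBarrier M S p) := by
  obtain ⟨M, hM⟩ := exists_isOptimal P
  by_cases hconn : P.Connects M univ
  · exact ⟨M, hM.1, Or.inl hconn⟩
  · exact ⟨M, hM.1, Or.inr ⟨_, P.part M, hM.isBarrier hcap hconn⟩⟩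

end AugmentationProblem

/-! ### Tough graphs and sparse cuts -/

section Tough

variable {V : Type*} [DecidableEq V] [Fintype V] {Γ : SimpleGraph V} {t : ℝ}

/-- Toughness in terms of colourings: if `c` is constant along the edges of `Γ` that avoid `S`, then
the number of its colours outside `S`, once it is at least two, is at most `#S / t`. Such colourings
are the unions of components of `Γ \ S`, so for `t ≥ 0` this is the usual notion. -/
def IsTough (Γ : SimpleGraph V) (t : ℝ) : Prop :=
  ∀ (S : Finset V) (c : V → V), (∀ x y, x ∉ S → y ∉ S → Γ.Adj x y → c x = c y) →
    2 ≤ #(Sᶜ.image c) → t * #(Sᶜ.image c) ≤ #S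

lemma IsTough.mul_le_card (h : IsTough Γ t) (ht : 0 ≤ t) {κ : Type*} [DecidableEq κ]
    {S : Finset V} {c : V → κ} (hc : ∀ x y, x ∉ S → y ∉ S → Γ.Adj x y → c x = c y) {k : ℕ}
    (hk : 2 ≤ k) (hkc : k ≤ #(Sᶜ.image c)) : t * k ≤ #S := by
  obtain ⟨d, hd⟩ := exists_self_coloring c
  replace hkc : k ≤ #(Sᶜ.image d) :=
    hkc.trans (card_image_le_card_image fun x _ y _ => (hd x y).2)
  calc t * k ≤ t * #(Sᶜ.image d) := by gcongr
    _ ≤ #S := h S d (fun x y hx hy hxy => (hd x y).1 (hc x y hx hy hxy)) (hk.trans hkc)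

end Tough

section ColorWeight

variable {V κ : Type*} [Fintype V] [DecidableEq κ] {r : ℕ} {p : V → κ} {g : V → ℕ}

/-- The total weight of the vertices whose colour lies in `Q`. -/
def colorWeight (p : V → κ) (g : V → ℕ) (Q : Finset κ) : ℕ := ∑ x with p x ∈ Q, g x

lemma colorWeight_eq_sum (Q : Finset κ) : colorWeight p g Q = ∑ a ∈ Q, colorWeight p g {a} := by
  simp only [colorWeight, mem_singleton]
  rw [← sum_fiberwise_of_maps_to (t := Q) (g := p) fun x hx => (mem_filter.1 hx).2]
  refine sum_congr rfl fun a ha => sum_congr ?_ fun _ _ => rfl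
  ext x
  simp only [mem_filter, mem_univ, true_and, and_iff_right_iff_imp]
  exact fun hx => hx ▸ ha

/-- The colours of weight more than `r`. -/
def heavyColors (r : ℕ) (p : V → κ) (g : V → ℕ) : Finset κ :=
  {a ∈ univ.image p | r < colorWeight p g {a}}

/-- The colours of weight at most `r` with more than `r` vertices. Such a class contains a vertex of
weight zero. -/
def largeColors (r : ℕ) (p : V → κ) (g : V → ℕ) : Finset κ :=
  {a ∈ univ.image p \ heavyColors r p g | r < #{x | p x = a}}

/-- The colours of weight at most `r` with at most `r` vertices. -/
def smallColors (r : ℕ) (p : V → κ) (g : V → ℕ) : Finset κ :=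
  {a ∈ univ.image p \ heavyColors r p g | ¬ r < #{x | p x = a}}

lemma sum_image_eq_sum_colors (r : ℕ) (p : V → κ) (g : V → ℕ) (f : κ → ℕ) :
    ∑ a ∈ univ.image p, f a = ∑ a ∈ heavyColors r p g, f a +
      ∑ a ∈ largeColors r p g, f a + ∑ a ∈ smallColors r p g, f a := by
  rw [add_assoc, largeColors, smallColors, sum_filter_add_sum_filter_not, add_comm]
  exact (sum_sdiff (filter_subset _ _)).symm

lemma mem_largeColors {a : κ} : a ∈ largeColors r p g ↔
    a ∈ univ.image p ∧ colorWeight p g {a} ≤ r ∧ r < #{x | p x = a} := by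
  simp only [largeColors, heavyColors, mem_filter, mem_sdiff]
  grind

lemma mem_smallColors {a : κ} : a ∈ smallColors r p g ↔
    a ∈ univ.image p ∧ colorWeight p g {a} ≤ r ∧ #{x | p x = a} ≤ r := by
  simp only [smallColors, heavyColors, mem_filter, mem_sdiff]
  grind

lemma mem_colors (r : ℕ) (p : V → κ) (g : V → ℕ) (x : V) :
    p x ∈ heavyColors r p g ∨ p x ∈ largeColors r p g ∨ p x ∈ smallColors r p g := by
  have hx := mem_image_of_mem p (mem_univ x)
  simp only [heavyColors, mem_largeColors, mem_smallColors, mem_filter, hx, true_and]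
  omega

lemma mul_card_heavyColors_le :
    (r + 1) * #(heavyColors r p g) ≤ colorWeight p g (heavyColors r p g) := by
  rw [colorWeight_eq_sum, mul_comm, ← smul_eq_mul]
  exact card_nsmul_le_sum _ _ _ fun a ha => (mem_filter.1 ha).2

/-- The vertices of positive weight outside the small classes. Deleting them separates the large
classes from each other and destroys none of them. -/
def separator (r : ℕ) (p : V → κ) (g : V → ℕ) : Finset V :=
  {x | p x ∉ smallColors r p g ∧ 0 < g x}

lemma card_separator_le : #(separator r p g) ≤
    colorWeight p g (heavyColors r p g) + colorWeight p g (largeColors r p g) := by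
  have hsub : separator r p g ⊆
      ({x | p x ∈ heavyColors r p g ∪ largeColors r p g} : Finset V) := fun x hx => by
    simp only [separator, mem_filter_univ, mem_union] at hx ⊢
    exact (or_assoc.2 (mem_colors r p g x)).resolve_right hx.1
  calc #(separator r p g) = ∑ x ∈ separator r p g, 1 := card_eq_sum_ones _
    _ ≤ ∑ x ∈ separator r p g, g x := sum_le_sum fun x hx => ((mem_filter_univ x).1 hx).2
    _ ≤ colorWeight p g (heavyColors r p g ∪ largeColors r p g) := sum_le_sum_of_subset hsub
    _ ≤ _ := by
      simp only [colorWeight_eq_sum (_ ∪ _), colorWeight_eq_sum (heavyColors r p g),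
        colorWeight_eq_sum (largeColors r p g)]
      exact le_self_add.trans sum_union_inter.le

lemma exists_notMem_separator {a : κ} (ha : a ∈ largeColors r p g) :
    ∃ x, p x = a ∧ x ∉ separator r p g := by
  obtain ⟨-, hle, hlt⟩ := mem_largeColors.1 ha
  by_contra! h
  have hcard : #{x | p x = a} ≤ colorWeight p g {a} := by
    simp only [colorWeight, mem_singleton]
    rw [card_eq_sum_ones]
    exact sum_le_sum fun x hx =>
      ((mem_filter_univ x).1 (h x ((mem_filter_univ x).1 hx))).2
  omega

end ColorWeight

section SparseCut

variable {V κ : Type*} [DecidableEq V] [Fintype V] [DecidableEq κ] {m r : ℕ}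
  {H : Finset (Sym2 V)} {p : V → κ} {g : V → ℕ}

lemma sum_edgeDegree_univ {K : Finset (Sym2 V)} (hK : ∀ e ∈ K, ¬ e.IsDiag) :
    ∑ x, edgeDegree K x = 2 * #K := by
  simp_rw [edgeDegree, card_filter]
  rw [sum_comm, mul_comm, ← smul_eq_mul, ← sum_const]
  refine sum_congr rfl fun e he => ?_
  rw [← card_filter, ← Sym2.card_toFinset_of_not_isDiag e (hK e he)]
  congr 1
  ext x
  simp

lemma card_le_card_filter_mem_sym2_add_sum (K : Finset (Sym2 V)) (X : Finset V) :
    #K ≤ #{e ∈ K | e ∈ X.sym2} + ∑ x ∈ Xᶜ, edgeDegree K x := by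
  have hsub : K ⊆ {e ∈ K | e ∈ X.sym2} ∪ Xᶜ.biUnion fun x => {e ∈ K | x ∈ e} := by
    intro e he
    simp only [mem_union, mem_filter, mem_biUnion, mem_compl, he, true_and, mem_sym2_iff]
    by_contra! h
    obtain ⟨⟨x, hxe, hxX⟩, h⟩ := h
    exact h x hxX hxe
  exact (card_le_card hsub).trans
    ((card_union_le _ _).trans (Nat.add_le_add_left card_biUnion_le _))

/-- A partition into the colour classes of `p` with few edges of `H` between its classes. The weight
`g` is the degree in the graph of crossing edges, up to one additional unit in total. -/
structure IsSparseCut (m r : ℕ) (H : Finset (Sym2 V)) (p : V → κ) (g : V → ℕ) : Prop where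
  edgeDegree_le : ∀ x, edgeDegree (crossEdges H univ p) x ≤ g x
  sum_le : ∑ x, g x ≤ 2 * #(crossEdges H univ p) + 1
  le_colorWeight : ∀ a ∈ univ.image p, #{x | p x = a} ≤ r → r ≤ colorWeight p g {a}
  le_surplus : ∀ Q ⊆ univ.image p, Q.Nonempty → m ≤ surplus m H {x | p x ∈ Q} p
  lt_surplus : m < surplus m H univ p

namespace IsSparseCut

lemma colorWeight_smallColors (h : IsSparseCut m r H p g) :
    colorWeight p g (smallColors r p g) = r * #(smallColors r p g) := by
  rw [colorWeight_eq_sum, mul_comm, ← smul_eq_mul]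
  refine sum_eq_card_nsmul fun a ha => ?_
  obtain ⟨ha, hle, hcard⟩ := mem_smallColors.1 ha
  exact hle.antisymm (h.le_colorWeight a ha hcard)

lemma colorWeight_add_le (h : IsSparseCut m r H p g) :
    colorWeight p g (heavyColors r p g) + colorWeight p g (largeColors r p g) +
      r * #(smallColors r p g) ≤ 2 * #(crossEdges H univ p) + 1 := by
  have hsum := sum_image_eq_sum_colors r p g fun a => colorWeight p g {a}
  rw [← colorWeight_eq_sum, ← colorWeight_eq_sum, ← colorWeight_eq_sum, ← colorWeight_eq_sum,
    h.colorWeight_smallColors] at hsum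
  rw [← hsum]
  exact (sum_le_sum_of_subset (filter_subset _ _)).trans h.sum_le

lemma colorWeight_heavy_add_large_le (h : IsSparseCut m r H p g) (hr : 2 * m ≤ r) :
    colorWeight p g (heavyColors r p g) + colorWeight p g (largeColors r p g) + 2 * m + 1 ≤
      2 * m * (#(heavyColors r p g) + #(largeColors r p g)) := by
  have hweight := h.colorWeight_add_le
  have hlt := h.lt_surplus
  have hcard := sum_image_eq_sum_colors r p g fun _ => 1
  simp only [← card_eq_sum_ones] at hcard
  have hsmall : 2 * m * #(smallColors r p g) ≤ r * #(smallColors r p g) := Nat.mul_le_mul_right _ hr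
  rw [surplus, hcard] at hlt
  zify at *
  linarith

lemma colorWeight_heavy_le (h : IsSparseCut m r H p g) (hr : 2 * m ≤ r)
    (hne : (heavyColors r p g).Nonempty) :
    colorWeight p g (heavyColors r p g) + 2 * m ≤
      2 * m * #(heavyColors r p g) + colorWeight p g (largeColors r p g) + 1 := by
  set Q := heavyColors r p g ∪ smallColors r p g with hQ
  have hsub : Q ⊆ univ.image p := union_subset (filter_subset _ _)
    ((filter_subset _ _).trans sdiff_subset)
  have hdisj : Disjoint (heavyColors r p g) (smallColors r p g) :=
    disjoint_sdiff.mono_right (filter_subset _ _)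
  have himage : ({x | p x ∈ Q} : Finset V).image p = Q := by
    ext a
    simp only [mem_image, mem_filter_univ]
    refine ⟨fun ⟨_, hx, hxa⟩ => hxa ▸ hx, fun ha => ?_⟩
    obtain ⟨x, -, rfl⟩ := mem_image.1 (hsub ha)
    exact ⟨x, ha, rfl⟩
  have hcompl : ∑ x ∈ ({x | p x ∈ Q} : Finset V)ᶜ, edgeDegree (crossEdges H univ p) x ≤
      colorWeight p g (largeColors r p g) := by
    refine (sum_le_sum fun x _ => h.edgeDegree_le x).trans (sum_le_sum_of_subset fun x hx => ?_)
    simp only [hQ, mem_compl, mem_filter_univ, mem_union, not_or] at hx ⊢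
    exact ((mem_colors r p g x).resolve_left hx.1).resolve_right hx.2
  have hinside : #{e ∈ crossEdges H univ p | e ∈ ({x | p x ∈ Q} : Finset V).sym2} ≤
      #(crossEdges H {x | p x ∈ Q} p) := card_le_card fun e he => by
    simp only [crossEdges, mem_filter] at he ⊢
    exact ⟨he.1.1, he.2, he.1.2.2⟩
  have hedges := card_le_card_filter_mem_sym2_add_sum (crossEdges H univ p) {x | p x ∈ Q}
  have hweight := h.colorWeight_add_le
  have hsurplus := h.le_surplus Q hsub (hne.mono subset_union_left)
  have hsmall : 2 * m * #(smallColors r p g) ≤ r * #(smallColors r p g) := Nat.mul_le_mul_right _ hr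
  rw [surplus, himage, hQ, card_union_of_disjoint hdisj, ← hQ] at hsurplus
  zify at *
  linarith

lemma two_le_card_largeColors (h : IsSparseCut m r H p g) (hr : 2 * m ≤ r) :
    2 ≤ #(largeColors r p g) := by
  have hle := h.colorWeight_heavy_add_large_le hr
  have hheavy := mul_card_heavyColors_le (r := r) (p := p) (g := g)
  by_contra! hlt
  have hlarge : 2 * m * #(largeColors r p g) ≤ 2 * m * 1 := Nat.mul_le_mul_left _ (by omega)
  have hmul : 2 * m * #(heavyColors r p g) ≤ (r + 1) * #(heavyColors r p g) :=
    Nat.mul_le_mul_right _ (by omega)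
  linarith

lemma colorWeight_mul_lt (h : IsSparseCut m r H p g) (hm : 1 ≤ m) (hr : 2 * m ≤ r) :
    ((colorWeight p g (heavyColors r p g) + colorWeight p g (largeColors r p g) : ℕ) : ℤ) *
      (r + 1 - 2 * m) < 2 * m * r * #(largeColors r p g) := by
  have hle := h.colorWeight_heavy_add_large_le hr
  have hheavy := mul_card_heavyColors_le (r := r) (p := p) (g := g)
  have hne := h.colorWeight_heavy_le hr
  rw [← card_pos] at hne
  generalize colorWeight p g (heavyColors r p g) = a at *
  generalize colorWeight p g (largeColors r p g) = c at *
  generalize #(heavyColors r p g) = k at *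
  generalize #(largeColors r p g) = l at *
  zify at *
  suffices hk : 2 * m * r * k < r * (2 * m + 1) + (2 * m - 1) * (a + c : ℤ) by
    have := mul_le_mul_of_nonneg_left hle (Nat.cast_nonneg (α := ℤ) r)
    linarith
  have hr0 : (0 : ℤ) < r * (2 * m + 1) := by nlinarith
  rcases (Nat.cast_nonneg (α := ℤ) k).eq_or_lt with hk | hk
  · rw [← hk, mul_zero]
    nlinarith
  · have hac : 2 * (r + 1 - m) * k ≤ (a + c : ℤ) := by linarith [hne hk]
    have hcoeff : 2 * m * r ≤ (2 * m - 1) * (2 * (r + 1 - m) : ℤ) := by nlinarith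
    have := mul_le_mul_of_nonneg_right hcoeff hk.le
    have := mul_le_mul_of_nonneg_left hac (show (0 : ℤ) ≤ 2 * m - 1 by linarith)
    linarith

lemma notMem_largeColors_of_mem_crossEdges (h : IsSparseCut m r H p g) {x y : V}
    (hxy : s(x, y) ∈ crossEdges H univ p) (hx : x ∉ separator r p g) : p x ∉ largeColors r p g := by
  have hpos := (edgeDegree_pos hxy (Sym2.mem_mk_left x y)).trans_le (h.edgeDegree_le x)
  have hsmall : p x ∈ smallColors r p g := by
    by_contra hx'
    exact hx ((mem_filter_univ x).2 ⟨hx', hpos⟩)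
  rw [mem_largeColors]
  have := (mem_smallColors.1 hsmall).2.2
  omega

lemma mul_card_largeColors_le (h : IsSparseCut m r H p g) (hr : 2 * m ≤ r) {Γ : SimpleGraph V}
    {t : ℝ} (ht : 0 ≤ t) (htough : IsTough Γ t) (hΓ : ∀ x y, x ∉ separator r p g →
      y ∉ separator r p g → Γ.Adj x y → p x ≠ p y → s(x, y) ∈ H) :
    t * #(largeColors r p g) ≤ #(separator r p g) := by
  refine htough.mul_le_card ht
    (c := fun x => if p x ∈ largeColors r p g then some (p x) else none)
    (fun x y hx hy hxy => ?_) (h.two_le_card_largeColors hr) ?_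
  · by_cases hp : p x = p y
    · simp only [hp]
    have hcross : s(x, y) ∈ crossEdges H univ p :=
      mk_mem_crossEdges.2 ⟨hΓ x y hx hy hxy hp, by simp, hp⟩
    rw [if_neg (h.notMem_largeColors_of_mem_crossEdges hcross hx),
      if_neg (h.notMem_largeColors_of_mem_crossEdges (Sym2.eq_swap ▸ hcross) hy)]
  · rw [← card_image_of_injective _ (Option.some_injective κ)]
    refine card_le_card fun o ho => ?_
    obtain ⟨a, ha, rfl⟩ := mem_image.1 ho
    obtain ⟨x, rfl, hx⟩ := exists_notMem_separator ha
    exact mem_image.2 ⟨x, mem_compl.2 hx, if_pos ha⟩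

end IsSparseCut

lemma IsTough.not_isSparseCut {Γ : SimpleGraph V} {t : ℝ} (htough : IsTough Γ t) (hm : 1 ≤ m)
    (hr : 2 * m ≤ r) (ht : 2 * (m : ℝ) * r ≤ t * (r + 1 - 2 * m))
    (hΓ : ∀ x y, x ∉ separator r p g → y ∉ separator r p g → Γ.Adj x y → p x ≠ p y → s(x, y) ∈ H) :
    ¬ IsSparseCut m r H p g := by
  intro h
  have hpos : (0 : ℝ) < r + 1 - 2 * m := by
    have : (2 * m : ℝ) ≤ r := mod_cast hr
    linarith
  have ht0 : 0 ≤ t := by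
    by_contra! hneg
    nlinarith [mul_neg_of_neg_of_pos hneg hpos, show (0 : ℝ) ≤ 2 * m * r by positivity]
  have hweight : ((colorWeight p g (heavyColors r p g) + colorWeight p g (largeColors r p g) : ℕ) :
      ℝ) * (r + 1 - 2 * m) < 2 * m * r * #(largeColors r p g) :=
    mod_cast h.colorWeight_mul_lt hm hr
  refine hweight.not_ge ?_
  calc 2 * (m : ℝ) * r * #(largeColors r p g)
      ≤ t * (r + 1 - 2 * m) * #(largeColors r p g) := by gcongr
    _ = t * #(largeColors r p g) * (r + 1 - 2 * m) := by ring
    _ ≤ _ := by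
      have := (h.mul_card_largeColors_le hr ht0 htough hΓ).trans (Nat.cast_le.2 card_separator_le)
      gcongr

end SparseCut

section NearlyRegular

variable {V κ : Type*} [DecidableEq V] [DecidableEq κ] {m r : ℕ} {E F M : Finset (Sym2 V)}

lemma edgeDegree_union (h : Disjoint E F) (v : V) :
    edgeDegree (E ∪ F) v = edgeDegree E v + edgeDegree F v := by
  rw [edgeDegree, filter_union, card_union_of_disjoint (disjoint_filter_filter h)]
  rfl

variable [Fintype V] {p : V → κ}

lemma edgeDegree_add_one_le (hE : ∀ e ∈ E, ¬ e.IsDiag) (p : V → κ) (x : V) :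
    edgeDegree E x + 1 ≤ edgeDegree (crossEdges E univ p) x + #{y | p y = p x} := by
  have hsub : ({e ∈ E | x ∈ e} : Finset (Sym2 V)) ⊆
      ({e ∈ crossEdges E univ p | x ∈ e} : Finset (Sym2 V)) ∪
        (({y | p y = p x} : Finset V).erase x).image fun y => s(x, y) := by
    intro e he
    obtain ⟨he, hxe⟩ := mem_filter.1 he
    obtain ⟨y, rfl⟩ := Sym2.mem_iff_exists.1 hxe
    rw [mem_union, mem_filter, mk_mem_crossEdges, mem_image]
    by_cases h : p x = p y
    · refine Or.inr ⟨y, mem_erase.2 ⟨?_, by simp [h]⟩, rfl⟩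
      rintro rfl
      exact hE _ he (by simp)
    · exact Or.inl ⟨⟨he, by simp, h⟩, hxe⟩
  have hcard := (card_le_card hsub).trans ((card_union_le _ _).trans
    (Nat.add_le_add_left card_image_le _))
  have herase := card_erase_add_one (s := ({y | p y = p x} : Finset V)) (a := x) (by simp)
  simp only [edgeDegree]
  omega

/-- Every vertex of a class with at most `r` vertices sends at least `r + 1 - #class` edges out of
it, and `k (r + 1 - k) ≥ r` for `1 ≤ k ≤ r`. -/
lemma add_card_le_colorWeight (hE : ∀ e ∈ E, ¬ e.IsDiag) (hr : ∀ x, r ≤ edgeDegree E x) {a : κ}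
    (ha : a ∈ univ.image p) (hcard : #{x | p x = a} ≤ r) :
    r + #{x | p x = a ∧ r < edgeDegree E x} ≤
      colorWeight p (edgeDegree (crossEdges E univ p)) {a} := by
  have hpos : 0 < #{x | p x = a} := by
    obtain ⟨x, -, hx⟩ := mem_image.1 ha
    exact card_pos.2 ⟨x, by simpa using hx⟩
  have hsum : ∑ x with p x = a, (r + 1 + if r < edgeDegree E x then 1 else 0) ≤
      ∑ x with p x = a, (edgeDegree (crossEdges E univ p) x + #{x | p x = a}) := by
    refine sum_le_sum fun x hx => ?_
    obtain rfl := (mem_filter_univ x).1 hx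
    have := edgeDegree_add_one_le hE p x
    have := hr x
    split_ifs <;> omega
  simp only [sum_add_distrib, sum_const, smul_eq_mul, ← card_filter, filter_filter] at hsum
  simp only [colorWeight, mem_singleton]
  generalize #{x | p x = a} = k at *
  obtain ⟨k, rfl⟩ := Nat.exists_eq_add_of_le' hpos
  obtain ⟨l, rfl⟩ := Nat.exists_eq_add_of_le hcard
  nlinarith

/-- All degrees are equal to `r`, except that one degree may be `r + 1`. -/
structure IsNearlyRegular (r : ℕ) (F : Finset (Sym2 V)) : Prop where
  le_edgeDegree : ∀ x, r ≤ edgeDegree F x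
  sum_le : ∑ x, (edgeDegree F x - r) ≤ 1

lemma IsNearlyRegular.edgeDegree_le (hF : IsNearlyRegular r F) (x : V) :
    edgeDegree F x ≤ r + 1 := by
  have := (single_le_sum (fun y _ => Nat.zero_le (edgeDegree F y - r)) (mem_univ x)).trans hF.sum_le
  omega

open Classical in
/-- The problem of adding edges of `Γ` to `F`, keeping all degrees at most `r + 1`. -/
noncomputable def boundedAugmentation (m r : ℕ) (Γ : SimpleGraph V) (F : Finset (Sym2 V)) :
    AugmentationProblem V where
  m := m
  base := F
  extra := {e | e ∈ Γ.edgeSet ∧ e ∉ F}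
  capacity x := r + 1 - edgeDegree F x
  not_isDiag _ he := Γ.not_isDiag_of_mem_edgeSet ((mem_filter_univ _).1 he).1
  disjoint := disjoint_left.2 fun _ he => ((mem_filter_univ _).1 he).2

variable {Γ : SimpleGraph V}

lemma mem_extra_boundedAugmentation {e : Sym2 V} :
    e ∈ (boundedAugmentation m r Γ F).extra ↔ e ∈ Γ.edgeSet ∧ e ∉ F := by
  simp [boundedAugmentation]

section Admissible

variable (hF : IsNearlyRegular r F) (hM : (boundedAugmentation m r Γ F).IsAdmissible M)
include hM

lemma edgeDegree_union_of_isAdmissible (x : V) :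
    edgeDegree (F ∪ M) x = edgeDegree F x + edgeDegree M x :=
  edgeDegree_union ((boundedAugmentation m r Γ F).disjoint.mono_left hM.1).symm x

lemma mem_edgeSet_of_isAdmissible (hFΓ : ∀ e ∈ F, e ∈ Γ.edgeSet) {e : Sym2 V} (he : e ∈ F ∪ M) :
    e ∈ Γ.edgeSet :=
  (mem_union.1 he).elim (hFΓ e) fun he => (mem_extra_boundedAugmentation.1 (hM.1 he)).1

include hF

lemma edgeDegree_eq_or_eq_of_isAdmissible (x : V) :
    edgeDegree (F ∪ M) x = r ∨ edgeDegree (F ∪ M) x = r + 1 := by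
  have hadd := edgeDegree_union_of_isAdmissible hM x
  have hcap : edgeDegree M x ≤ r + 1 - edgeDegree F x := hM.2 x
  have := hF.le_edgeDegree x
  have := hF.edgeDegree_le x
  omega

end Admissible

/-- The degree in the graph of crossing edges, with the excess degree of `F` over `r` added. -/
def crossWeight (r : ℕ) (F M : Finset (Sym2 V)) (p : V → κ) (x : V) : ℕ :=
  edgeDegree (crossEdges (F ∪ M) univ p) x + (edgeDegree F x - r)

namespace AugmentationProblem.IsBarrier

variable {S : Finset V} (hS : (boundedAugmentation m r Γ F).IsBarrier M S p)
  (hF : IsNearlyRegular r F) (hM : (boundedAugmentation m r Γ F).IsAdmissible M)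
include hS hF

lemma crossWeight_pos {x : V} (hx : x ∈ S) : 0 < crossWeight r F M p x := by
  have hsat : edgeDegree M x = r + 1 - edgeDegree F x := hS.saturated x hx
  have hle := hF.edgeDegree_le x
  rw [crossWeight]
  rcases hle.lt_or_eq with hlt | heq
  · obtain ⟨e, he⟩ := card_pos.1 (show 0 < edgeDegree M x by omega)
    obtain ⟨he, hxe⟩ := mem_filter.1 he
    obtain ⟨y, rfl⟩ := Sym2.mem_iff_exists.1 hxe
    exact Nat.add_pos_left (edgeDegree_pos (mk_mem_crossEdges.2
      ⟨mem_union_right _ he, by simp, hS.color_ne x hx y he⟩) hxe) _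
  · omega

include hM

lemma isSparseCut (hFΓ : ∀ e ∈ F, e ∈ Γ.edgeSet) :
    IsSparseCut m r (F ∪ M) p (crossWeight r F M p) where
  edgeDegree_le x := le_self_add
  sum_le := by
    have hdiag : ∀ e ∈ crossEdges (F ∪ M) univ p, ¬ e.IsDiag := fun e he =>
      Γ.not_isDiag_of_mem_edgeSet (mem_edgeSet_of_isAdmissible hM hFΓ (crossEdges_subset he))
    simp only [crossWeight]
    rw [sum_add_distrib, sum_edgeDegree_univ hdiag]
    exact Nat.add_le_add_left hF.sum_le _
  le_colorWeight a ha hcard := by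
    refine le_self_add.trans ((add_card_le_colorWeight (fun e he => Γ.not_isDiag_of_mem_edgeSet
      (mem_edgeSet_of_isAdmissible hM hFΓ he)) (fun x => ?_) ha hcard).trans
      (sum_le_sum fun x _ => le_self_add))
    rcases edgeDegree_eq_or_eq_of_isAdmissible hF hM x with h | h <;> omega
  le_surplus := hS.le_surplus
  lt_surplus := hS.lt_surplus

lemma subset_separator (hFΓ : ∀ e ∈ F, e ∈ Γ.edgeSet) :
    S ⊆ separator r p (crossWeight r F M p) := by
  intro x hx
  refine (mem_filter_univ x).2 ⟨fun hsmall => ?_, hS.crossWeight_pos hF hx⟩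
  obtain ⟨ha, hle, hcard⟩ := mem_smallColors.1 hsmall
  have hdeg : ∀ y, r ≤ edgeDegree (F ∪ M) y := fun y => by
    rcases edgeDegree_eq_or_eq_of_isAdmissible hF hM y with h | h <;> omega
  have hlt : r < edgeDegree (F ∪ M) x := by
    have hsat : edgeDegree M x = r + 1 - edgeDegree F x := hS.saturated x hx
    rw [edgeDegree_union_of_isAdmissible hM]
    omega
  have hpos : 0 < #{y | p y = p x ∧ r < edgeDegree (F ∪ M) y} := card_pos.2 ⟨x, by simpa using hlt⟩
  have hadd := add_card_le_colorWeight (fun e he => Γ.not_isDiag_of_mem_edgeSet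
    (mem_edgeSet_of_isAdmissible hM hFΓ he)) hdeg ha hcard
  have hweight : colorWeight p (edgeDegree (crossEdges (F ∪ M) univ p)) {p x} ≤
      colorWeight p (crossWeight r F M p) {p x} := sum_le_sum fun y _ => le_self_add
  omega

end AugmentationProblem.IsBarrier

theorem IsTough.exists_isPartitionConnected_union {t : ℝ} (htough : IsTough Γ t) (hm : 1 ≤ m)
    (hr : 2 * m ≤ r) (ht : 2 * (m : ℝ) * r ≤ t * (r + 1 - 2 * m)) (hFΓ : ∀ e ∈ F, e ∈ Γ.edgeSet)
    (hF : IsNearlyRegular r F) : ∃ H : Finset (Sym2 V), (∀ e ∈ H, e ∈ Γ.edgeSet) ∧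
      IsPartitionConnected m H univ ∧ ∀ x, edgeDegree H x = r ∨ edgeDegree H x = r + 1 := by
  obtain ⟨M, hM, hconn | ⟨S, p, hS⟩⟩ :=
    (boundedAugmentation m r Γ F).exists_connects_or_isBarrier fun x =>
      Nat.sub_le_iff_le_add.2 (by have := hF.le_edgeDegree x; omega)
  · exact ⟨F ∪ M, fun _ => mem_edgeSet_of_isAdmissible hM hFΓ, hconn,
      edgeDegree_eq_or_eq_of_isAdmissible hF hM⟩
  · have hsub := hS.subset_separator hF hM hFΓ
    refine absurd (hS.isSparseCut hF hM hFΓ) (htough.not_isSparseCut hm hr ht ?_)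
    intro x y hx hy hxy hne
    by_contra hH
    exact hne (hS.color_eq x y (fun h => hx (hsub h)) (fun h => hy (hsub h))
      (mem_extra_boundedAugmentation.2 ⟨hxy, fun h => hH (mem_union_left _ h)⟩))

end NearlyRegular

/-! ### Disjoint spanning trees -/

section MatroidUnion

variable {ι σ : Type*} {M : σ → Matroid ι} {H : Finset ι} {I J : σ → Finset ι}

/-- Pairwise disjoint subsets `I i` of `H`, the `i`-th being independent in `M i`. -/
structure IsPacking (M : σ → Matroid ι) (H : Finset ι) (I : σ → Finset ι) : Prop where
  subset : ∀ i, I i ⊆ H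
  disjoint : Pairwise fun i j => Disjoint (I i) (I j)
  indep : ∀ i, (M i).Indep (I i)

lemma closure_insert_sdiff_singleton_eq {N : Matroid ι} {A : Set ι} {x y : ι} (hy : y ∈ A)
    (hxA : x ∈ N.closure A) (hx : x ∉ N.closure (A \ {y})) :
    N.closure (insert x (A \ {y})) = N.closure A := by
  rw [N.closure_insert_congr (f := y), Set.insert_sdiff_singleton, Set.insert_eq_of_mem hy]
  rw [Set.insert_sdiff_singleton, Set.insert_eq_of_mem hy]
  exact ⟨hxA, hx⟩

/-- A packing that covers as many elements as possible. -/
structure IsMaximumPacking [Fintype σ] (M : σ → Matroid ι) (H : Finset ι) (I : σ → Finset ι) : Prop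
    extends IsPacking M H I where
  sum_card_le : ∀ J, IsPacking M H J → ∑ i, #(J i) ≤ ∑ i, #(I i)

lemma exists_isMaximumPacking [Fintype σ] (M : σ → Matroid ι) (H : Finset ι) :
    ∃ I, IsMaximumPacking M H I := by
  classical
  obtain ⟨I, hI, hmax⟩ := exists_max_image
    ({I ∈ Fintype.piFinset fun _ : σ => H.powerset | IsPacking M H I}) (fun I => ∑ i, #(I i))
    ⟨fun _ => ∅, mem_filter.2 ⟨by simp, by simp, by simp [Pairwise], by simp⟩⟩
  refine ⟨I, (mem_filter.1 hI).2, fun J hJ => hmax J (mem_filter.2 ⟨?_, hJ⟩)⟩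
  exact Fintype.mem_piFinset.2 fun i => mem_powerset.2 (hJ.subset i)

lemma IsPacking.update [DecidableEq ι] [DecidableEq σ] (hI : IsPacking M H I) {i : σ}
    {A : Finset ι} {x : ι} (hx : x ∈ H) (hxI : ∀ j, x ∉ I j) (hA : A ⊆ insert x (I i))
    (hind : (M i).Indep A) : IsPacking M H (Function.update I i A) := by
  have hdisj : ∀ j, j ≠ i → Disjoint A (I j) := fun j hj =>
    Disjoint.mono_left hA (disjoint_insert_left.2 ⟨hxI j, hI.disjoint hj.symm⟩)
  refine ⟨fun j => ?_, fun j l hjl => ?_, fun j => ?_⟩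
  · rcases eq_or_ne j i with rfl | h
    · simpa using hA.trans (insert_subset hx (hI.subset j))
    · simpa [h] using hI.subset j
  · rcases eq_or_ne j i with rfl | h
    · simpa [hjl.symm] using hdisj l hjl.symm
    · rcases eq_or_ne l i with rfl | h'
      · simpa [h] using (hdisj j h).symm
      · simpa [h, h'] using hI.disjoint hjl
  · rcases eq_or_ne j i with rfl | h
    · simpa using hind
    · simpa [h] using hI.indep j

lemma IsMaximumPacking.mem_closure [Fintype σ] (hI : IsMaximumPacking M H I)
    (hHE : ∀ i, (H : Set ι) ⊆ (M i).E) {x : ι} (hx : x ∈ H) (hxI : ∀ j, x ∉ I j) (i : σ) :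
    x ∈ (M i).closure (I i) := by
  classical
  by_contra hno
  have hind : (M i).Indep (insert x (I i) : Finset ι) := by
    rw [coe_insert]
    exact ((hI.indep i).notMem_closure_iff_of_notMem (mod_cast hxI i) (hHE i hx)).1 hno
  have hle := hI.sum_card_le _ (hI.update hx hxI subset_rfl hind)
  rw [Fintype.sum_eq_add_sum_compl i, Fintype.sum_eq_add_sum_compl i, Function.update_self,
    card_insert_of_notMem (hxI i),
    sum_congr rfl fun j hj => by rw [Function.update_of_ne (by simpa using hj)]] at hle
  omega

section Exchange

variable [DecidableEq ι] [DecidableEq σ]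

/-- `J` arises from `I` by replacing an element of one member by an element of `H` that no member
contains, the new member being independent. -/
def Exchange (M : σ → Matroid ι) (H : Finset ι) (I J : σ → Finset ι) : Prop :=
  ∃ i x y, x ∈ H ∧ (∀ j, x ∉ I j) ∧ y ∈ I i ∧ (M i).Indep (insert x ((I i).erase y) : Finset ι) ∧
    J = Function.update I i (insert x ((I i).erase y))

lemma Exchange.isPacking (h : Exchange M H I J) (hI : IsPacking M H I) : IsPacking M H J := by
  obtain ⟨i, x, y, hx, hxI, -, hind, rfl⟩ := h
  exact hI.update hx hxI (insert_subset_insert _ (erase_subset _ _)) hind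

lemma IsPacking.notMem_update_exchange (hI : IsPacking M H I) {i : σ} {x y : ι} (hy : y ∈ I i)
    (hx : x ∉ I i) (j : σ) : y ∉ Function.update I i (insert x ((I i).erase y)) j := by
  rcases eq_or_ne j i with rfl | h
  · rw [Function.update_self, mem_insert, not_or]
    exact ⟨fun hyx => hx (hyx ▸ hy), notMem_erase _ _⟩
  · rw [Function.update_of_ne h]
    exact disjoint_left.1 (hI.disjoint h.symm) hy

lemma Exchange.symm (h : Exchange M H I J) (hI : IsPacking M H I) : Exchange M H J I := by
  obtain ⟨i, x, y, -, hxI, hy, -, rfl⟩ := h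
  have herase : insert y ((insert x ((I i).erase y)).erase x) = I i := by
    rw [erase_insert fun hx' => hxI i (mem_of_mem_erase hx'), insert_erase hy]
  refine ⟨i, y, x, hI.subset i hy, hI.notMem_update_exchange hy (hxI i), by simp, ?_, ?_⟩
  · simpa only [Function.update_self, herase] using hI.indep i
  · simp only [Function.update_self, herase, Function.update_idem, Function.update_eq_self]

open Classical in
/-- The elements of `H` that become uncovered after a suitable sequence of exchanges. -/
noncomputable def freeElements (M : σ → Matroid ι) (H : Finset ι) (I : σ → Finset ι) : Finset ι :=
  {x ∈ H | ∃ J, Relation.ReflTransGen (Exchange M H) I J ∧ ∀ j, x ∉ J j}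

lemma mem_freeElements {x : ι} : x ∈ freeElements M H I ↔
    x ∈ H ∧ ∃ J, Relation.ReflTransGen (Exchange M H) I J ∧ ∀ j, x ∉ J j := by
  simp [freeElements]

lemma mem_freeElements_of_forall_notMem {x : ι} (hx : x ∈ H) (hxI : ∀ j, x ∉ I j) :
    x ∈ freeElements M H I :=
  mem_freeElements.2 ⟨hx, I, .refl, hxI⟩

lemma IsPacking.mem_freeElements_of_indep_exchange (hI : IsPacking M H I) {i : σ} {x y : ι}
    (hx : x ∈ H) (hxI : ∀ j, x ∉ I j) (hy : y ∈ I i)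
    (hind : (M i).Indep (insert x ((I i).erase y) : Finset ι)) : y ∈ freeElements M H I :=
  mem_freeElements.2 ⟨hI.subset i hy, _, .single ⟨i, x, y, hx, hxI, hy, hind, rfl⟩,
    hI.notMem_update_exchange hy (hxI i)⟩

lemma Exchange.freeElements_eq (h : Exchange M H I J) (hI : IsPacking M H I) :
    freeElements M H I = freeElements M H J := by
  ext x
  simp only [mem_freeElements]
  exact ⟨fun ⟨hx, L, hL, hxL⟩ => ⟨hx, L, .head (h.symm hI) hL, hxL⟩,
    fun ⟨hx, L, hL, hxL⟩ => ⟨hx, L, .head h hL, hxL⟩⟩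

variable [Fintype σ]

lemma Exchange.sum_card (h : Exchange M H I J) : ∑ i, #(J i) = ∑ i, #(I i) := by
  obtain ⟨i, x, y, -, hxI, hy, -, rfl⟩ := h
  refine sum_congr rfl fun j _ => ?_
  rcases eq_or_ne j i with rfl | h
  · rw [Function.update_self, card_insert_of_notMem fun hx' => hxI j (mem_of_mem_erase hx'),
      card_erase_add_one hy]
  · rw [Function.update_of_ne h]

lemma Exchange.isMaximumPacking (h : Exchange M H I J) (hI : IsMaximumPacking M H I) :
    IsMaximumPacking M H J :=
  ⟨h.isPacking hI.toIsPacking, fun L hL => h.sum_card ▸ hI.sum_card_le L hL⟩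

namespace IsMaximumPacking

variable (hI : IsMaximumPacking M H I) (hHE : ∀ i, (H : Set ι) ⊆ (M i).E)
include hI hHE

lemma mem_closure_inter_freeElements {x : ι} (hx : x ∈ H) (hxI : ∀ j, x ∉ I j) (i : σ) :
    x ∈ (M i).closure (I i ∩ freeElements M H I : Finset ι) := by
  have hcl := hI.mem_closure hHE hx hxI i
  have hxi : x ∉ (I i : Set ι) := mod_cast hxI i
  have hcircuit := (hI.indep i).fundCircuit_isCircuit hcl hxi
  refine (M i).closure_subset_closure ?_
    (hcircuit.mem_closure_sdiff_singleton_of_mem ((M i).mem_fundCircuit x (I i)))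
  rintro y ⟨hyC, hyx : y ≠ x⟩
  have hyI : y ∈ I i := mod_cast ((M i).fundCircuit_subset_insert x _ hyC).resolve_left hyx
  refine mod_cast mem_inter.2 ⟨hyI, hI.mem_freeElements_of_indep_exchange hx hxI hyI ?_⟩
  rw [coe_insert, coe_erase, Set.insert_sdiff_singleton_comm hyx.symm]
  exact ((hI.indep i).mem_fundCircuit_iff hcl hxi).1 hyC

lemma closure_eq_of_exchange (h : Exchange M H I J) (i : σ) :
    (M i).closure (J i ∩ freeElements M H J : Finset ι) =
      (M i).closure (I i ∩ freeElements M H I : Finset ι) := by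
  rw [← h.freeElements_eq hI.toIsPacking]
  obtain ⟨j, x, y, hx, hxI, hy, hind, rfl⟩ := h
  rcases ne_or_eq i j with hij | rfl
  · rw [Function.update_of_ne hij]
  have hxF : x ∈ freeElements M H I := mem_freeElements_of_forall_notMem hx hxI
  have hyF := hI.mem_freeElements_of_indep_exchange hx hxI hy hind
  rw [Function.update_self, insert_inter_of_mem hxF, erase_inter, coe_insert, coe_erase]
  refine closure_insert_sdiff_singleton_eq (mod_cast mem_inter.2 ⟨hy, hyF⟩)
    (hI.mem_closure_inter_freeElements hHE hx hxI i) fun hmem => ?_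
  rw [coe_insert, coe_erase, Matroid.insert_indep_iff] at hind
  refine (hind.2 fun hxi => hxI i hxi.1).2 ((M i).closure_subset_closure ?_ hmem)
  exact Set.sdiff_subset_sdiff_left (by simp)

lemma closure_eq_of_reflTransGen (h : Relation.ReflTransGen (Exchange M H) I J) (i : σ) :
    (M i).closure (J i ∩ freeElements M H J : Finset ι) =
      (M i).closure (I i ∩ freeElements M H I : Finset ι) ∧ IsMaximumPacking M H J := by
  induction h with
  | refl => exact ⟨rfl, hI⟩
  | tail _ h ih => exact ⟨(ih.2.closure_eq_of_exchange hHE h i).trans ih.1, h.isMaximumPacking ih.2⟩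

lemma isBasis_inter_freeElements (i : σ) :
    (M i).IsBasis (I i ∩ freeElements M H I : Finset ι) (freeElements M H I) := by
  refine ((hI.indep i).subset (mod_cast inter_subset_left)).isBasis_of_subset_of_subset_closure
    (mod_cast inter_subset_right) fun x hx => ?_
  obtain ⟨hxH, J, hJ, hxJ⟩ := mem_freeElements.1 (mem_coe.1 hx)
  obtain ⟨hcl, hmax⟩ := hI.closure_eq_of_reflTransGen hHE hJ i
  exact hcl ▸ hmax.mem_closure_inter_freeElements hHE hxH hxJ i

end IsMaximumPacking

end Exchange

/-- The matroid union theorem: the defect of a largest packing is explained by the set `X`. -/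
theorem exists_isPacking_isBasis [Finite σ] [DecidableEq ι] (M : σ → Matroid ι) {H : Finset ι}
    (hHE : ∀ i, (H : Set ι) ⊆ (M i).E) : ∃ I, IsPacking M H I ∧ ∃ X ⊆ H,
      (∀ x ∈ H, (∀ i, x ∉ I i) → x ∈ X) ∧ ∀ i, (M i).IsBasis (I i ∩ X : Finset ι) X := by
  classical
  cases nonempty_fintype σ
  obtain ⟨I, hI⟩ := exists_isMaximumPacking M H
  exact ⟨I, hI.toIsPacking, freeElements M H I, fun x hx => (mem_freeElements.1 hx).1,
    fun x hx hxI => mem_freeElements_of_forall_notMem hx hxI, hI.isBasis_inter_freeElements hHE⟩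

end MatroidUnion

section LinearMatroid

variable {ι k W : Type*} [Field k] [AddCommGroup W] [Module k W] {χ : ι → W}

lemma finrank_span_image_eq_card {I : Finset ι} (hI : LinearIndepOn k χ I) :
    Module.finrank k (Submodule.span k (χ '' I)) = #I := by
  have h := finrank_span_eq_card (R := k) (b := fun x : (I : Set ι) => χ x) hI
  rw [← Set.image_eq_range] at h
  simpa using h

lemma exists_linearIndepOn_insert {I J : Finset ι} (hI : LinearIndepOn k χ I)
    (hJ : LinearIndepOn k χ J) (hIJ : #I < #J) :
    ∃ x ∈ J, x ∉ I ∧ LinearIndepOn k χ (insert x (I : Set ι)) := by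
  by_contra! hno
  have hle : Submodule.span k (χ '' J) ≤ Submodule.span k (χ '' I) := by
    rw [Submodule.span_le]
    rintro _ ⟨x, hx, rfl⟩
    exact hI.mem_span_iff.2 fun hins => not_not.1 fun hxI => hno x hx hxI hins
  have : FiniteDimensional k (Submodule.span k (χ '' I)) :=
    .span_of_finite k (I.finite_toSet.image χ)
  refine hIJ.not_ge ?_
  simpa only [finrank_span_image_eq_card hI, finrank_span_image_eq_card hJ] using
    Submodule.finrank_mono hle

/-- The matroid represented over the field `k` by the vectors `χ x`. -/
def linearMatroid (k : Type*) [Field k] [Module k W] (χ : ι → W) : Matroid ι :=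
  (IndepMatroid.ofFinitaryCardAugment Set.univ (LinearIndepOn k χ) (linearIndepOn_empty k χ)
    (fun _ _ hJ hIJ => hJ.mono hIJ)
    (fun I J hI hIfin hJ hJfin hIJ => by
      lift I to Finset ι using hIfin
      lift J to Finset ι using hJfin
      simpa only [Set.ncard_coe_finset, mem_coe] using exists_linearIndepOn_insert hI hJ
        (by simpa only [Set.ncard_coe_finset] using hIJ))
    (fun I h => linearIndepOn_of_finite I fun J hJI hJ => h J hJI hJ)
    (fun _ _ => Set.subset_univ _)).matroid

@[simp] lemma linearMatroid_indep_iff {I : Set ι} :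
    (linearMatroid k χ).Indep I ↔ LinearIndepOn k χ I := by
  simp [linearMatroid]

@[simp] lemma linearMatroid_ground : (linearMatroid k χ).E = Set.univ := rfl

lemma span_image_eq_of_isBasis {B X : Set ι} (h : (linearMatroid k χ).IsBasis B X) :
    Submodule.span k (χ '' B) = Submodule.span k (χ '' X) := by
  refine le_antisymm (Submodule.span_mono (Set.image_mono h.subset)) ?_
  rw [Submodule.span_le]
  rintro _ ⟨x, hx, rfl⟩
  exact (linearMatroid_indep_iff.1 h.indep).mem_span_iff.2 fun hins =>
    h.mem_of_insert_indep hx (linearMatroid_indep_iff.2 hins)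

end LinearMatroid

section Trees

variable {V : Type*} [DecidableEq V]

/-- The incidence vector of an edge over the field with two elements; that of a loop is zero. -/
def incidenceVector : Sym2 V → V → ZMod 2 :=
  Sym2.lift ⟨fun x y => Pi.single x 1 + Pi.single y 1, fun _ _ => add_comm _ _⟩

lemma incidenceVector_mk (x y : V) : incidenceVector s(x, y) = Pi.single x 1 + Pi.single y 1 := rfl

/-- Sets of edges that are linearly independent in the binary cycle matroid, that is, forests. -/
abbrev IsIndepEdgeSet (I : Finset (Sym2 V)) : Prop :=
  LinearIndepOn (ZMod 2) incidenceVector (I : Set (Sym2 V))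

lemma IsIndepEdgeSet.not_injective_cycle {I : Finset (Sym2 V)} (hI : IsIndepEdgeSet I) {k : ℕ}
    (v : Fin (k + 1) → V) (hv : ∀ i, s(v i, v (i + 1)) ∈ I) :
    ¬ Function.Injective fun i => s(v i, v (i + 1)) := by
  intro hinj
  have h := LinearIndependent.comp (R := ZMod 2) (v := fun x : (I : Set (Sym2 V)) =>
    incidenceVector x.1) hI (fun i => ⟨s(v i, v (i + 1)), hv i⟩)
    fun i j hij => hinj (congrArg Subtype.val hij)
  refine one_ne_zero (Fintype.linearIndependent_iff.1 h (fun _ => (1 : ZMod 2)) ?_ 0)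
  simp only [Function.comp_apply, one_smul, incidenceVector_mk, sum_add_distrib]
  have hshift := Equiv.sum_comp (Equiv.addRight (1 : Fin (k + 1)))
    fun i => (Pi.single (v i) 1 : V → ZMod 2)
  simp only [Equiv.coe_addRight] at hshift
  rw [hshift, ZModModule.add_self]

/-- The sum of the coordinates in `C`. -/
def coordSum (C : Finset V) : (V → ZMod 2) →ₗ[ZMod 2] ZMod 2 :=
  ∑ v ∈ C, LinearMap.proj v

lemma coordSum_single (C : Finset V) (x : V) :
    coordSum C (Pi.single x 1) = if x ∈ C then 1 else 0 := by
  simp [coordSum, LinearMap.sum_apply, Pi.single_apply]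

lemma coordSum_incidenceVector {C : Finset V} {x y : V} :
    coordSum C (incidenceVector s(x, y)) = 0 ↔ (x ∈ C ↔ y ∈ C) := by
  rw [incidenceVector_mk, map_add, coordSum_single, coordSum_single]
  split_ifs <;> simp_all [ZModModule.add_self]

lemma span_incidenceVector_le_ker {C : Finset V} {I : Set (Sym2 V)}
    (h : ∀ x y, s(x, y) ∈ I → (x ∈ C ↔ y ∈ C)) :
    Submodule.span (ZMod 2) (incidenceVector '' I) ≤ LinearMap.ker (coordSum C) := by
  rw [Submodule.span_le]
  rintro _ ⟨⟨x, y⟩, he, rfl⟩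
  exact coordSum_incidenceVector.2 (h x y he)

lemma mkQ_single_eq_of_incidenceVector_mem {S : Submodule (ZMod 2) (V → ZMod 2)} {x y : V}
    (h : incidenceVector s(x, y) ∈ S) : S.mkQ (Pi.single x 1) = S.mkQ (Pi.single y 1) := by
  rw [incidenceVector_mk, ← S.ker_mkQ, LinearMap.mem_ker, map_add] at h
  rw [eq_neg_of_add_eq_zero_left h, ZModModule.neg_eq_self]

lemma finrank_ker_coordSum_univ_lt {V : Type*} [Fintype V] [Nonempty V] :
    Module.finrank (ZMod 2) (LinearMap.ker (coordSum (univ : Finset V))) < Fintype.card V := by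
  classical
  rw [← Module.finrank_fintype_fun_eq_card (R := ZMod 2) (η := V)]
  refine Submodule.finrank_lt fun htop => ?_
  obtain ⟨x⟩ := ‹Nonempty V›
  have hx : (Pi.single x 1 : V → ZMod 2) ∈ LinearMap.ker (coordSum univ) := htop ▸ trivial
  rw [LinearMap.mem_ker, coordSum_single, if_pos (mem_univ _)] at hx
  exact one_ne_zero hx

variable [Fintype V]

lemma IsIndepEdgeSet.card_lt [Nonempty V] {I : Finset (Sym2 V)} (hI : IsIndepEdgeSet I) :
    #I < Fintype.card V := by
  rw [← finrank_span_image_eq_card hI]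
  exact (Submodule.finrank_mono (span_incidenceVector_le_ker (by simp))).trans_lt
    finrank_ker_coordSum_univ_lt

lemma IsIndepEdgeSet.reflTransGen [Nonempty V] {I : Finset (Sym2 V)} (hI : IsIndepEdgeSet I)
    (hc : #I + 1 = Fintype.card V) (x y : V) :
    Relation.ReflTransGen (fun a b => s(a, b) ∈ I) x y := by
  classical
  let C : Finset V := {z | Relation.ReflTransGen (fun a b => s(a, b) ∈ I) x z}
  have hspan : Submodule.span (ZMod 2) (incidenceVector '' (I : Set (Sym2 V))) =
      LinearMap.ker (coordSum univ) := by
    refine Submodule.eq_of_le_of_finrank_le (span_incidenceVector_le_ker (by simp)) ?_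
    have := finrank_ker_coordSum_univ_lt (V := V)
    rw [finrank_span_image_eq_card hI]
    omega
  have hC : ∀ a b, s(a, b) ∈ (I : Set (Sym2 V)) → (a ∈ C ↔ b ∈ C) := fun a b hab => by
    simp only [C, mem_filter, mem_univ, true_and]
    exact ⟨fun h => h.tail hab, fun h => h.tail (Sym2.eq_swap ▸ hab)⟩
  have hxy : incidenceVector s(x, y) ∈ LinearMap.ker (coordSum univ) :=
    coordSum_incidenceVector.2 (by simp)
  have hiff : x ∈ C ↔ y ∈ C :=
    coordSum_incidenceVector.1 (span_incidenceVector_le_ker hC (hspan ▸ hxy))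
  have hx : x ∈ C := by simp [C, Relation.ReflTransGen.refl]
  simpa only [C, mem_filter, mem_univ, true_and] using hiff.1 hx

lemma card_le_finrank_add_card_image {k : Type*} [Field k] (S : Submodule k (V → k))
    [DecidableEq ((V → k) ⧸ S)] :
    Fintype.card V ≤ Module.finrank k S + #(univ.image fun v => S.mkQ (Pi.single v 1)) := by
  have hspan : Submodule.span k (Set.range fun v => S.mkQ (Pi.single v 1)) = ⊤ := by
    have hsingle : (fun v => S.mkQ (Pi.single v 1)) = S.mkQ ∘ Pi.basisFun k V := by
      ext v; simp
    rw [hsingle, Set.range_comp, ← Submodule.map_span, (Pi.basisFun k V).span_eq,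
      Submodule.map_top, S.range_mkQ]
  have hle := finrank_span_finset_le_card (R := k) (univ.image fun v => S.mkQ (Pi.single v 1))
  rw [Set.finrank, coe_image, coe_univ, Set.image_univ, hspan, finrank_top] at hle
  have := S.finrank_quotient_add_finrank
  rw [Module.finrank_fintype_fun_eq_card] at this
  omega

/-- The theorem of Nash-Williams and Tutte, by matroid union for `m` copies of the cycle matroid. -/
theorem exists_tree_packing [Nonempty V] {m : ℕ} {H : Finset (Sym2 V)}
    (hH : IsPartitionConnected m H univ) :
    ∃ I : Fin m → Finset (Sym2 V), (∀ i, I i ⊆ H) ∧ (Pairwise fun i j => Disjoint (I i) (I j)) ∧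
      ∀ i, IsIndepEdgeSet (I i) ∧ #(I i) + 1 = Fintype.card V := by
  classical
  obtain ⟨I, hI, X, -, hX, hbasis⟩ :=
    exists_isPacking_isBasis (fun _ : Fin m => linearMatroid (ZMod 2) incidenceVector)
      (H := H) (by simp)
  have hindep : ∀ i, IsIndepEdgeSet (I i) := fun i => linearMatroid_indep_iff.1 (hI.indep i)
  refine ⟨I, hI.subset, hI.disjoint, fun i₀ => ⟨hindep i₀, ?_⟩⟩
  let S := Submodule.span (ZMod 2) (incidenceVector '' (X : Set (Sym2 V)))
  let c : V → (V → ZMod 2) ⧸ S := fun v => S.mkQ (Pi.single v 1)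
  have hcard : ∀ i, #(I i \ X) + Module.finrank (ZMod 2) S = #(I i) := fun i => by
    have hspan : Submodule.span (ZMod 2) (incidenceVector '' (I i ∩ X : Finset (Sym2 V))) = S :=
      span_image_eq_of_isBasis (hbasis i)
    rw [← hspan, finrank_span_image_eq_card ((hindep i).mono (mod_cast inter_subset_left)),
      card_sdiff_add_card_inter]
  have hcross : #(crossEdges H univ c) ≤ ∑ i, #(I i \ X) := by
    refine (card_le_card ?_).trans card_biUnion_le
    rintro ⟨x, y⟩ he
    obtain ⟨heH, -, hne⟩ := mk_mem_crossEdges.1 he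
    have heX : s(x, y) ∉ X := fun heX => hne <|
      mkQ_single_eq_of_incidenceVector_mem (Submodule.subset_span ⟨_, heX, rfl⟩)
    obtain ⟨i, hi⟩ : ∃ i, s(x, y) ∈ I i := by
      by_contra! hno
      exact heX (hX _ heH hno)
    exact mem_biUnion.2 ⟨i, mem_univ _, mem_sdiff.2 ⟨hi, heX⟩⟩
  have hsurplus := hH.surplus_le c
  have himage : m * Fintype.card V ≤ m * (Module.finrank (ZMod 2) S + #(univ.image c)) :=
    Nat.mul_le_mul_left m (card_le_finrank_add_card_image S)
  by_contra hne
  have hlt : ∑ i, (#(I i) + 1) < ∑ _i : Fin m, Fintype.card V :=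
    sum_lt_sum (fun i _ => (hindep i).card_lt)
      ⟨i₀, mem_univ _, lt_of_le_of_ne (hindep i₀).card_lt hne⟩
  simp only [← hcard, sum_add_distrib, sum_const, card_univ, Fintype.card_fin, smul_eq_mul,
    mul_one] at hlt
  rw [surplus] at hsurplus
  rw [mul_add] at himage
  omega

end Trees

/-! ### Factors with prescribed degrees -/

section Tutte

variable {W : Type*} [Fintype W] {K : SimpleGraph W}

/-- The set given by Tutte's theorem leaves at least two odd components too many, by parity. -/
lemma exists_add_two_le_ncard_oddComponents (heven : Even (Fintype.card W))
    (hK : ¬ ∃ M : K.Subgraph, M.IsPerfectMatching) :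
    ∃ u : Set W, u.ncard + 2 ≤ ((⊤ : K.Subgraph).deleteVerts u).coe.oddComponents.ncard := by
  classical
  rw [SimpleGraph.tutte] at hK
  push Not at hK
  obtain ⟨u, hu⟩ := hK
  refine ⟨u, ?_⟩
  have hodd := ((⊤ : K.Subgraph).deleteVerts u).coe.odd_ncard_oddComponents
  have hcard : Nat.card ((⊤ : K.Subgraph).deleteVerts u).verts + u.ncard = Fintype.card W := by
    rw [Nat.card_coe_set_eq, SimpleGraph.Subgraph.deleteVerts_verts, SimpleGraph.Subgraph.verts_top,
      Set.ncard_sdiff_add_ncard_of_subset (Set.subset_univ u), Set.ncard_univ,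
      Nat.card_eq_fintype_card]
  have hlt : u.ncard < ((⊤ : K.Subgraph).deleteVerts u).coe.oddComponents.ncard := hu
  rw [← hcard, Nat.even_iff] at heven
  simp only [Nat.odd_iff] at hodd
  omega

lemma exists_odd_coloring [DecidableEq W] (heven : Even (Fintype.card W))
    (hK : ¬ ∃ M : K.Subgraph, M.IsPerfectMatching) :
    ∃ (X : Finset W) (p : W → W), (∀ x ∉ X, ∀ y ∉ X, K.Adj x y → p x = p y) ∧
      #X + 2 ≤ #{a ∈ Xᶜ.image p | Odd #{x ∈ Xᶜ | p x = a}} := by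
  classical
  obtain ⟨u, hu⟩ := exists_add_two_le_ncard_oddComponents heven hK
  set L := ((⊤ : K.Subgraph).deleteVerts u).coe with hL
  have hverts : ∀ x, x ∉ u ↔ x ∈ ((⊤ : K.Subgraph).deleteVerts u).verts := by simp
  let comp : W → Option L.ConnectedComponent := fun x =>
    if hx : x ∉ u then some (L.connectedComponentMk ⟨x, (hverts x).1 hx⟩) else none
  have hcomp : ∀ x, comp x.1 = some (L.connectedComponentMk x) := fun x =>
    dif_pos ((hverts x).2 x.2)
  obtain ⟨p, hp⟩ := exists_self_coloring comp
  refine ⟨u.toFinset, p, fun x hx y hy hxy => ?_, ?_⟩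
  · rw [Set.mem_toFinset, hverts] at hx hy
    rw [← hp, hcomp ⟨x, hx⟩, hcomp ⟨y, hy⟩, Option.some_inj, SimpleGraph.ConnectedComponent.eq]
    refine SimpleGraph.Adj.reachable ?_
    rw [hL, SimpleGraph.Subgraph.coe_adj, SimpleGraph.Subgraph.deleteVerts_adj]
    exact ⟨trivial, (hverts x).2 hx, trivial, (hverts y).2 hy, hxy⟩
  rw [← Set.ncard_eq_toFinset_card']
  refine hu.trans ?_
  rw [Set.ncard_eq_toFinset_card']
  have hp' : ∀ x y : ((⊤ : K.Subgraph).deleteVerts u).verts,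
      p x = p y ↔ L.connectedComponentMk x = L.connectedComponentMk y := fun x y => by
    rw [← hp, hcomp, hcomp, Option.some_inj]
  refine card_le_card_of_injOn (fun C => p C.out) (fun C hC => ?_) fun C _ D _ hCD => ?_
  · have hclass : ({x ∈ u.toFinsetᶜ | p x = p C.out} : Finset W) = Subtype.val '' C.supp := by
      ext x
      simp only [coe_filter, mem_compl, Set.mem_toFinset, Set.mem_ofPred_eq, Set.mem_image,
        SimpleGraph.ConnectedComponent.mem_supp_iff]
      constructor
      · rintro ⟨hxu, hx⟩
        exact ⟨⟨x, (hverts x).1 hxu⟩, ((hp' _ _).1 hx).trans C.out_eq, rfl⟩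
      · rintro ⟨x, hx, rfl⟩
        exact ⟨(hverts x).2 x.2, (hp' _ _).2 (hx.trans C.out_eq.symm)⟩
    refine mem_filter.2 ⟨mem_image_of_mem p ?_, ?_⟩
    · simpa using (hverts _).2 C.out.2
    · rw [← Set.ncard_coe_finset, hclass, Set.ncard_image_of_injective _ Subtype.val_injective]
      simpa using hC
  · exact C.out_eq.symm.trans (((hp' _ _).1 hCD).trans D.out_eq)

end Tutte

section Factor

variable {V : Type*}

section Degree

variable (Γ : SimpleGraph V) [DecidableRel Γ.Adj] {A B : Finset V} {v : V}

/-- The number of neighbours of `v` in `A`. -/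
def degreeIn (A : Finset V) (v : V) : ℕ := #{w ∈ A | Γ.Adj v w}

variable [Fintype V]

lemma degreeIn_univ (v : V) : degreeIn Γ univ v = Γ.degree v := by
  rw [degreeIn, ← SimpleGraph.card_neighborFinset_eq_degree, SimpleGraph.neighborFinset_eq_filter]

variable [DecidableEq V]

lemma degreeIn_add_degreeIn_compl (A : Finset V) (v : V) :
    degreeIn Γ A v + degreeIn Γ Aᶜ v = Γ.degree v := by
  rw [degreeIn, degreeIn, ← degreeIn_univ, degreeIn, ← union_compl A, filter_union,
    card_union_of_disjoint (disjoint_filter_filter disjoint_compl_right)]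

lemma card_darts (A B : Finset V) :
    #{d : Γ.Dart | d.fst ∈ A ∧ d.snd ∈ B} = ∑ v ∈ A, degreeIn Γ B v := by
  simp only [degreeIn]
  rw [← card_sigma]
  refine card_bij (fun d _ => ⟨d.fst, d.snd⟩) (fun d hd => ?_) (fun d _ d' _ h => ?_) ?_
  · rw [mem_filter_univ] at hd
    exact mem_sigma.2 ⟨hd.1, mem_filter.2 ⟨hd.2, d.adj⟩⟩
  · simp only [Sigma.mk.injEq, heq_eq_eq] at h
    exact SimpleGraph.Dart.ext _ _ (Prod.ext h.1 h.2)
  · rintro ⟨v, w⟩ h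
    rw [mem_sigma, mem_filter] at h
    exact ⟨⟨(v, w), h.2.2⟩, by simpa using ⟨h.1, h.2.1⟩, rfl⟩

end Degree

lemma edgeDegree_image_edge [DecidableEq V] {Γ : SimpleGraph V} {D : Finset Γ.Dart}
    (hD : ∀ d ∈ D, d.symm ∈ D) (v : V) :
    edgeDegree (D.image SimpleGraph.Dart.edge) v = #{d ∈ D | d.fst = v} := by
  rw [edgeDegree]
  symm
  refine card_bij (fun d _ => d.edge) (fun d hd => ?_) (fun d hd d' hd' h => ?_) fun e he => ?_
  · obtain ⟨hdD, rfl⟩ := mem_filter.1 hd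
    exact mem_filter.2 ⟨mem_image_of_mem _ hdD, Sym2.mem_mk_left _ _⟩
  · rw [mem_filter] at hd hd'
    refine ((SimpleGraph.dart_edge_eq_iff d d').1 h).resolve_right ?_
    rintro rfl
    exact d'.snd_ne_fst (hd.2.trans hd'.2.symm)
  · obtain ⟨he, hv⟩ := mem_filter.1 he
    obtain ⟨d, hd, rfl⟩ := mem_image.1 he
    obtain rfl | rfl := Sym2.mem_iff.1 hv
    · exact ⟨d, mem_filter.2 ⟨hd, rfl⟩, rfl⟩
    · exact ⟨d.symm, mem_filter.2 ⟨hD d hd, rfl⟩, d.edge_symm⟩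

lemma even_card_of_symm_mem {Γ : SimpleGraph V} {D : Finset Γ.Dart} (hD : ∀ d ∈ D, d.symm ∈ D) :
    Even #D := by
  rw [← ZMod.natCast_eq_zero_iff_even, ← nsmul_one, ← sum_const]
  exact sum_involution (fun d _ => d.symm) (fun _ _ => CharTwo.add_self_eq_zero 1)
    (fun d _ _ => d.symm_ne) hD fun d _ => d.symm_symm

variable [Fintype V] {Γ : SimpleGraph V} [DecidableRel Γ.Adj] {f : V → ℕ}

/-- The vertices of Tutte's gadget: the darts of `Γ`, and `deg v - f v` core vertices for each
vertex `v`. -/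
abbrev GadgetVertex (Γ : SimpleGraph V) [DecidableRel Γ.Adj] (f : V → ℕ) : Type _ :=
  Γ.Dart ⊕ Σ v, Fin (Γ.degree v - f v)

/-- Tutte's gadget for `f`-factors: every dart is joined to its reverse and to all core vertices of
its source. A perfect matching uses up the cores of `v` on `deg v - f v` of the darts at `v` and
matches the other `f v` darts with their reverses. -/
def gadget (Γ : SimpleGraph V) [DecidableRel Γ.Adj] (f : V → ℕ) :
    SimpleGraph (GadgetVertex Γ f) where
  Adj
    | .inl d, .inl d' => d' = d.symm
    | .inl d, .inr e => d.fst = e.1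
    | .inr e, .inl d => d.fst = e.1
    | .inr _, .inr _ => False
  symm := ⟨by
    rintro (d | e) (d' | e') h
    · exact (congrArg SimpleGraph.Dart.symm h).trans d.symm_symm |>.symm
    all_goals exact h⟩
  loopless := ⟨by
    rintro (d | e) h
    · exact d.symm_ne h.symm
    · exact h⟩

lemma even_card_gadgetVertex (hf : ∀ v, f v ≤ Γ.degree v) (heven : Even (∑ v, f v)) :
    Even (Fintype.card (GadgetVertex Γ f)) := by
  have hsum : ∑ v, Γ.degree v = ∑ v, (Γ.degree v - f v) + ∑ v, f v := by
    rw [← sum_add_distrib]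
    exact sum_congr rfl fun v _ => (Nat.sub_add_cancel (hf v)).symm
  rw [Fintype.card_sum, Γ.dart_card_eq_sum_degrees, Fintype.card_sigma]
  simp only [Fintype.card_fin]
  rw [Nat.even_iff] at heven ⊢
  omega

section PerfectMatching

variable {M : (gadget Γ f).Subgraph}

lemma card_unmatched_darts [DecidableEq V] (hM : M.IsPerfectMatching) (v : V)
    [DecidablePred fun d : Γ.Dart => M.Adj (.inl d) (.inl d.symm)] :
    #{d : Γ.Dart | d.fst = v ∧ ¬ M.Adj (.inl d) (.inl d.symm)} = Γ.degree v - f v := by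
  rw [← Fintype.card_fin (Γ.degree v - f v), ← card_univ]
  symm
  have hM' := SimpleGraph.Subgraph.isPerfectMatching_iff.1 hM
  have hcore : ∀ i : Fin (Γ.degree v - f v), ∃ d : Γ.Dart, d.fst = v ∧
      M.Adj (.inr ⟨v, i⟩) (.inl d) := fun i => by
    obtain ⟨d | e, h, -⟩ := hM' (.inr ⟨v, i⟩)
    · exact ⟨d, M.adj_sub h, h⟩
    · exact (M.adj_sub h).elim
  choose q hq hq' using hcore
  refine card_bij (fun i _ => q i) (fun i _ => ?_) (fun i _ j _ hij => ?_) fun d hd => ?_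
  · exact (mem_filter_univ _).2 ⟨hq i, fun h =>
      Sum.inl_ne_inr ((hM' _).unique h (hq' i).symm)⟩
  · have hi := (hq' i).symm
    rw [hij] at hi
    exact eq_of_heq (Sigma.mk.inj (Sum.inr_injective ((hM' _).unique hi (hq' j).symm))).2
  · obtain ⟨rfl, hnot⟩ := (mem_filter_univ _).1 hd
    obtain ⟨d' | ⟨w, i⟩, h, -⟩ := hM' (.inl d)
    · obtain rfl : d' = d.symm := M.adj_sub h
      exact absurd h hnot
    · obtain rfl : d.fst = w := M.adj_sub h
      exact ⟨i, mem_univ _, Sum.inl_injective ((hM' _).unique (hq' i) h.symm)⟩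

lemma exists_factor_of_isPerfectMatching [DecidableEq V] (hf : ∀ v, f v ≤ Γ.degree v)
    (hM : M.IsPerfectMatching) :
    ∃ F : Finset (Sym2 V), (∀ e ∈ F, e ∈ Γ.edgeSet) ∧ ∀ v, edgeDegree F v = f v := by
  classical
  set D : Finset Γ.Dart := {d | M.Adj (.inl d) (.inl d.symm)} with hD
  refine ⟨D.image SimpleGraph.Dart.edge, fun e he => ?_, fun v => ?_⟩
  · obtain ⟨d, -, rfl⟩ := mem_image.1 he
    exact d.edge_mem
  rw [edgeDegree_image_edge fun d hd => by simpa [hD] using ((mem_filter_univ _).1 hd).symm,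
    filter_filter]
  have hunmatched := card_unmatched_darts hM v
  have hdegree := Γ.dart_fst_fiber_card_eq_degree v
  rw [← card_filter_add_card_filter_not fun d => M.Adj (.inl d) (.inl d.symm),
    filter_filter, filter_filter, hunmatched] at hdegree
  simp only [and_comm] at hdegree ⊢
  have := hf v
  omega

end PerfectMatching

section Deletion

variable [DecidableEq V]

/-- The vertices all of whose cores lie in the set `X` of gadget vertices. -/
def corelessSet (X : Finset (GadgetVertex Γ f)) : Finset V := {v | ∀ i, .inr ⟨v, i⟩ ∈ X}

/-- The vertices all of whose darts, but not all of whose cores, lie in `X`. -/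
def dartlessSet (X : Finset (GadgetVertex Γ f)) : Finset V :=
  {v | v ∉ corelessSet X ∧ ∀ d : Γ.Dart, d.fst = v → .inl d ∈ X}

/-- The vertices that keep both a core and a dart when `X` is deleted from the gadget. -/
def liveSet (X : Finset (GadgetVertex Γ f)) : Finset V := (dartlessSet X ∪ corelessSet X)ᶜ

variable {X : Finset (GadgetVertex Γ f)} {κ : Type*} {p : GadgetVertex Γ f → κ} {c : V → κ}

lemma mem_corelessSet {v : V} : v ∈ corelessSet X ↔ ∀ i, .inr ⟨v, i⟩ ∈ X := by simp [corelessSet]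

lemma notMem_corelessSet {v : V} : v ∉ corelessSet X ↔ ∃ i, .inr ⟨v, i⟩ ∉ X := by
  simp [mem_corelessSet]

lemma mem_dartlessSet {v : V} :
    v ∈ dartlessSet X ↔ v ∉ corelessSet X ∧ ∀ d : Γ.Dart, d.fst = v → .inl d ∈ X := by
  simp [dartlessSet]

lemma mem_liveSet {v : V} : v ∈ liveSet X ↔ v ∉ dartlessSet X ∧ v ∉ corelessSet X := by
  simp [liveSet]

lemma fst_notMem_dartlessSet {d : Γ.Dart} (hd : .inl d ∉ X) : d.fst ∉ dartlessSet X :=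
  fun h => hd ((mem_dartlessSet.1 h).2 d rfl)

lemma disjoint_dartlessSet_corelessSet : Disjoint (dartlessSet X) (corelessSet X) :=
  disjoint_left.2 fun _ hv => (mem_dartlessSet.1 hv).1

lemma exists_coloring_of_gadget_coloring [Nonempty κ]
    (hp : ∀ x ∉ X, ∀ y ∉ X, (gadget Γ f).Adj x y → p x = p y) :
    ∃ c : V → κ, ∀ d : Γ.Dart, .inl d ∉ X → d.fst ∉ corelessSet X → p (.inl d) = c d.fst := by
  have hcolor : ∀ v, ∃ a, ∀ d : Γ.Dart, .inl d ∉ X → v ∉ corelessSet X → d.fst = v →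
      p (.inl d) = a := fun v => by
    by_cases hv : v ∈ corelessSet X
    · exact ⟨Classical.arbitrary κ, fun _ _ hv' => absurd hv hv'⟩
    · obtain ⟨i, hi⟩ := notMem_corelessSet.1 hv
      exact ⟨p (.inr ⟨v, i⟩), fun d hd _ hdv => hp _ hd _ hi hdv⟩
  choose c hc using hcolor
  exact ⟨c, fun d hd hdT => hc _ d hd hdT rfl⟩

variable [DecidableEq κ]

lemma sum_sub_le_card_toRight : ∑ v ∈ corelessSet X, (Γ.degree v - f v) ≤ #X.toRight := by
  have hcores : ∑ v ∈ corelessSet X, (Γ.degree v - f v) =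
      #((corelessSet X).sigma fun v => (univ : Finset (Fin (Γ.degree v - f v)))) := by
    simp [card_sigma]
  rw [hcores]
  exact card_le_card fun e he => mem_toRight.2 (mem_corelessSet.1 (mem_sigma.1 he).1 e.2)

lemma card_crossEdges_liveSet_le
    (hp : ∀ x ∉ X, ∀ y ∉ X, (gadget Γ f).Adj x y → p x = p y)
    (hc : ∀ d : Γ.Dart, .inl d ∉ X → d.fst ∉ corelessSet X → p (.inl d) = c d.fst) :
    #(crossEdges Γ.edgeFinset (liveSet X) c) ≤
      #{d : Γ.Dart | .inl d ∈ X ∧ d.fst ∉ dartlessSet X ∧ d.snd ∈ liveSet X} := by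
  refine (card_le_card fun e he => ?_).trans (card_image_le (f := SimpleGraph.Dart.edge))
  induction e using Sym2.ind with
  | _ x y =>
    rw [mk_mem_crossEdges, SimpleGraph.mem_edgeFinset, SimpleGraph.mem_edgeSet] at he
    obtain ⟨hxy, ⟨hx, hy⟩, hne⟩ := he
    rw [mem_image]
    by_contra! hno
    have halive : ∀ d : Γ.Dart, d.edge = s(x, y) → d.fst ∈ liveSet X → d.snd ∈ liveSet X →
        .inl d ∉ X := fun d hd hfst hsnd hdX =>
      hno d ((mem_filter_univ _).2 ⟨hdX, (mem_liveSet.1 hfst).1, hsnd⟩) hd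
    have hd := halive ⟨(x, y), hxy⟩ rfl hx hy
    have hd' := halive ⟨(y, x), hxy.symm⟩ Sym2.eq_swap hy hx
    refine hne ((hc _ hd (mem_liveSet.1 hx).2).symm.trans ?_)
    exact (hp _ hd _ hd' rfl).trans (hc _ hd' (mem_liveSet.1 hy).2)

lemma sum_degree_add_card_le_card_toLeft :
    ∑ v ∈ dartlessSet X, Γ.degree v +
      #{d : Γ.Dart | .inl d ∈ X ∧ d.fst ∉ dartlessSet X ∧ d.snd ∈ corelessSet X} +
      #{d : Γ.Dart | .inl d ∈ X ∧ d.fst ∉ dartlessSet X ∧ d.snd ∈ liveSet X} ≤ #X.toLeft := by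
  have hdarts := card_darts Γ (dartlessSet X) univ
  simp only [degreeIn_univ] at hdarts
  rw [← hdarts, ← card_union_of_disjoint, ← card_union_of_disjoint]
  · refine card_le_card fun d hd => mem_toLeft.2 ?_
    simp only [mem_union, mem_filter_univ, mem_univ, and_true] at hd
    obtain (h | h) | h := hd
    · exact (mem_dartlessSet.1 h).2 d rfl
    · exact h.1
    · exact h.1
  · simp only [disjoint_left, mem_union, mem_filter_univ, mem_liveSet]
    tauto
  · simp only [disjoint_left, mem_filter_univ]
    tauto

lemma color_mem_image_or_exists_dart
    (hp : ∀ x ∉ X, ∀ y ∉ X, (gadget Γ f).Adj x y → p x = p y)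
    (hc : ∀ d : Γ.Dart, .inl d ∉ X → d.fst ∉ corelessSet X → p (.inl d) = c d.fst)
    {x : GadgetVertex Γ f} (hx : x ∉ X) :
    p x ∈ (liveSet X).image c ∨ p x ∈ ((dartlessSet X).sigma fun _ => univ).image (p ∘ .inr) ∨
      ∃ d : Γ.Dart, d.fst ∈ corelessSet X ∧ .inl d = x := by
  rcases x with d | ⟨v, i⟩
  · by_cases hdT : d.fst ∈ corelessSet X
    · exact Or.inr (Or.inr ⟨d, hdT, rfl⟩)
    · rw [hc d hx hdT]
      exact Or.inl (mem_image_of_mem c (mem_liveSet.2 ⟨fst_notMem_dartlessSet hx, hdT⟩))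
  · have hvT : v ∉ corelessSet X := notMem_corelessSet.2 ⟨i, hx⟩
    by_cases hvS : v ∈ dartlessSet X
    · exact Or.inr (Or.inl (mem_image_of_mem (p ∘ .inr) (mem_sigma.2 ⟨hvS, mem_univ i⟩)))
    · obtain ⟨d, rfl, hd⟩ : ∃ d : Γ.Dart, d.fst = v ∧ .inl d ∉ X := by
        by_contra! hno
        exact hvS (mem_dartlessSet.2 ⟨hvT, hno⟩)
      rw [hp _ hx _ hd rfl, hc d hd hvT]
      exact Or.inl (mem_image_of_mem c (mem_liveSet.2 ⟨hvS, hvT⟩))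

/-- A colour class that contains neither a core nor a dart of a vertex with a core consists of
darts, and if it contained the reverses of all of them then its size would be even. -/
lemma card_odd_colors_le
    (hp : ∀ x ∉ X, ∀ y ∉ X, (gadget Γ f).Adj x y → p x = p y)
    (hc : ∀ d : Γ.Dart, .inl d ∉ X → d.fst ∉ corelessSet X → p (.inl d) = c d.fst) :
    #{a ∈ Xᶜ.image p | Odd #{x ∈ Xᶜ | p x = a}} ≤
      #((liveSet X).image c) + ∑ v ∈ dartlessSet X, (Γ.degree v - f v) +
      #{d : Γ.Dart | .inl d ∉ X ∧ d.fst ∈ corelessSet X ∧ .inl d.symm ∈ X} := by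
  set cores := (dartlessSet X).sigma fun v => (univ : Finset (Fin (Γ.degree v - f v)))
  set border : Finset Γ.Dart := {d | .inl d ∉ X ∧ d.fst ∈ corelessSet X ∧ .inl d.symm ∈ X}
  have hcores : #(cores.image (p ∘ .inr)) ≤ ∑ v ∈ dartlessSet X, (Γ.degree v - f v) :=
    card_image_le.trans (by simp [cores, card_sigma])
  suffices hsub : {a ∈ Xᶜ.image p | Odd #{x ∈ Xᶜ | p x = a}} ⊆
      (liveSet X).image c ∪ cores.image (p ∘ .inr) ∪ border.image (p ∘ .inl) by
    have := card_le_card hsub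
    have := card_union_le ((liveSet X).image c ∪ cores.image (p ∘ .inr)) (border.image (p ∘ .inl))
    have := card_union_le ((liveSet X).image c) (cores.image (p ∘ .inr))
    have : #(border.image (p ∘ .inl)) ≤ #border := card_image_le
    omega
  intro a ha
  obtain ⟨-, hodd⟩ := mem_filter.1 ha
  by_contra hno
  simp only [mem_union, not_or] at hno
  obtain ⟨⟨hlive, hcore⟩, hborder⟩ := hno
  have hdart : ∀ x ∉ X, p x = a → ∃ d : Γ.Dart, d.fst ∈ corelessSet X ∧ .inl d = x := by
    rintro x hx rfl
    exact ((color_mem_image_or_exists_dart hp hc hx).resolve_left hlive).resolve_left hcore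
  have hclass : ({x ∈ Xᶜ | p x = a} : Finset _) =
      ({d : Γ.Dart | .inl d ∉ X ∧ p (.inl d) = a} : Finset _).map .inl := by
    ext x
    simp only [mem_filter, mem_compl, mem_map, mem_univ, true_and, Function.Embedding.inl_apply]
    refine ⟨fun ⟨hx, hpx⟩ => ?_, by rintro ⟨d, hd, rfl⟩; exact hd⟩
    obtain ⟨d, -, rfl⟩ := hdart x hx hpx
    exact ⟨d, ⟨hx, hpx⟩, rfl⟩
  rw [hclass, card_map, ← Nat.not_even_iff_odd] at hodd
  refine hodd (even_card_of_symm_mem fun d hd => ?_)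
  obtain ⟨hdX, rfl⟩ := (mem_filter_univ _).1 hd
  have hdT : d.fst ∈ corelessSet X := by
    obtain ⟨d', hdT, hd'⟩ := hdart _ hdX rfl
    rwa [← Sum.inl_injective hd']
  have hsymm : .inl d.symm ∉ X := fun h =>
    hborder (mem_image.2 ⟨d, (mem_filter_univ _).2 ⟨hdX, hdT, h⟩, rfl⟩)
  exact (mem_filter_univ _).2 ⟨hsymm, (hp _ hdX _ hsymm rfl).symm⟩

lemma card_border_le :
    #{d : Γ.Dart | .inl d ∉ X ∧ d.fst ∈ corelessSet X ∧ .inl d.symm ∈ X} ≤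
      #{d : Γ.Dart | .inl d ∈ X ∧ d.fst ∉ dartlessSet X ∧ d.snd ∈ corelessSet X} +
      ∑ v ∈ corelessSet X, degreeIn Γ (dartlessSet X) v := by
  rw [← card_darts, ← card_image_of_injective ({d : Γ.Dart | .inl d ∈ X ∧ _})
    SimpleGraph.Dart.symm_involutive.injective]
  refine (card_le_card fun d hd => ?_).trans (card_union_le _ _)
  simp only [mem_union, mem_image, mem_filter_univ] at hd ⊢
  by_cases hs : d.snd ∈ dartlessSet X
  · exact Or.inr ⟨hd.2.1, hs⟩
  · exact Or.inl ⟨d.symm, ⟨hd.2.2, hs, hd.2.1⟩, d.symm_symm⟩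

end Deletion

/-- The sufficiency part of Tutte's `f`-factor theorem, with colourings of the complement of `S ∪ T`
in place of its components. -/
theorem exists_factor [DecidableEq V] (heven : Even (∑ v, f v)) (hf : ∀ v, f v ≤ Γ.degree v)
    (h : ∀ S T : Finset V, Disjoint S T → ∀ c : V → V,
      #((S ∪ T)ᶜ.image c) + ∑ v ∈ T, f v ≤ ∑ v ∈ S, f v + ∑ v ∈ T, degreeIn Γ Sᶜ v +
        #(crossEdges Γ.edgeFinset (S ∪ T)ᶜ c) + 1) :
    ∃ F : Finset (Sym2 V), (∀ e ∈ F, e ∈ Γ.edgeSet) ∧ ∀ v, edgeDegree F v = f v := by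
  by_cases hM : ∃ M : (gadget Γ f).Subgraph, M.IsPerfectMatching
  · exact exists_factor_of_isPerfectMatching hf hM.choose_spec
  exfalso
  obtain ⟨X, p, hp, hodd⟩ := exists_odd_coloring (even_card_gadgetVertex hf heven) hM
  have : Nonempty (GadgetVertex Γ f) := by
    obtain ⟨a, -⟩ := card_pos.1 ((Nat.zero_lt_succ _).trans_le hodd)
    exact ⟨a⟩
  obtain ⟨c, hc⟩ := exists_coloring_of_gadget_coloring hp
  obtain ⟨d, hd⟩ := exists_self_coloring c
  have hcolors := card_odd_colors_le hp hc
  have hborder := card_border_le (X := X)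
  have hcores := sum_sub_le_card_toRight (X := X)
  have hdarts := sum_degree_add_card_le_card_toLeft (X := X)
  have hX := X.card_toLeft_add_card_toRight
  have hcross := (card_le_card (crossEdges_subset_crossEdges (E := Γ.edgeFinset)
    fun x (_ : x ∈ liveSet X) y _ => (hd x y).1)).trans (card_crossEdges_liveSet_le hp hc)
  have himage : #((liveSet X).image c) ≤ #((liveSet X).image d) :=
    card_image_le_card_image fun x _ y _ => (hd x y).2
  have hcond := h (dartlessSet X) (corelessSet X) disjoint_dartlessSet_corelessSet d
  have hsub : ∀ A : Finset V, ∑ v ∈ A, (Γ.degree v - f v) + ∑ v ∈ A, f v = ∑ v ∈ A, Γ.degree v :=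
    fun A => by
      rw [← sum_add_distrib]
      exact sum_congr rfl fun v _ => Nat.sub_add_cancel (hf v)
  have hdegree : ∑ v ∈ corelessSet X, degreeIn Γ (dartlessSet X) v +
      ∑ v ∈ corelessSet X, degreeIn Γ (dartlessSet X)ᶜ v = ∑ v ∈ corelessSet X, Γ.degree v := by
    simp only [← sum_add_distrib, degreeIn_add_degreeIn_compl]
  have := hsub (dartlessSet X)
  have := hsub (corelessSet X)
  rw [← liveSet] at hcond
  omega

end Factor

/-! ### Nearly regular factors of tough graphs -/

section Degree

variable {V : Type*} {Γ : SimpleGraph V} [DecidableRel Γ.Adj] {A B C U : Finset V}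

@[simp] lemma degreeIn_pos {v : V} : 0 < degreeIn Γ A v ↔ ∃ w ∈ A, Γ.Adj v w := by
  simp [degreeIn, card_pos, Finset.Nonempty]

lemma degreeIn_mono (h : A ⊆ B) (v : V) : degreeIn Γ A v ≤ degreeIn Γ B v :=
  card_le_card (filter_subset_filter _ h)

variable (Γ) in
lemma sum_degreeIn_comm (A B : Finset V) :
    ∑ v ∈ A, degreeIn Γ B v = ∑ w ∈ B, degreeIn Γ A w := by
  refine (sum_card_bipartiteAbove_eq_sum_card_bipartiteBelow Γ.Adj).trans ?_
  simp only [bipartiteBelow, degreeIn, Γ.adj_comm]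

lemma card_add_sum_degreeIn_le (hCU : Disjoint C U) (hCB : C ⊆ B) (hUB : U ⊆ B)
    (hC : ∀ v ∈ C, ∃ w ∈ A, Γ.Adj v w) :
    #C + ∑ v ∈ U, degreeIn Γ A v ≤ ∑ w ∈ A, degreeIn Γ B w := by
  classical
  rw [sum_degreeIn_comm Γ A B]
  calc #C + ∑ v ∈ U, degreeIn Γ A v
      ≤ ∑ v ∈ C, degreeIn Γ A v + ∑ v ∈ U, degreeIn Γ A v := by
        rw [card_eq_sum_ones]
        gcongr with v hv
        exact degreeIn_pos.2 (hC v hv)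
    _ = ∑ v ∈ C ∪ U, degreeIn Γ A v := (sum_union hCU).symm
    _ ≤ ∑ v ∈ B, degreeIn Γ A v := sum_le_sum_of_subset (union_subset hCB hUB)

lemma edgeDegree_edgeFinset [Fintype V] [DecidableEq V] (v : V) :
    edgeDegree Γ.edgeFinset v = Γ.degree v := by
  rw [edgeDegree, ← Γ.incidenceFinset_eq_filter, Γ.card_incidenceFinset_eq_degree]

end Degree

section Greedy

variable {V : Type*} (Γ : SimpleGraph V) [DecidableRel Γ.Adj]

/-- `I` is a maximal independent subset of `A`. -/
structure IsIndepDominating (A I : Finset V) : Prop where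
  subset : I ⊆ A
  indep : ∀ v ∈ I, ∀ w ∈ I, ¬ Γ.Adj v w
  dom : ∀ v ∈ A, v ∈ I ∨ ∃ w ∈ I, Γ.Adj v w

variable {Γ} in
lemma IsIndepDominating.insert [DecidableEq V] {A I : Finset V} {v : V} (hv : v ∈ A)
    (h : IsIndepDominating Γ {w ∈ A | w ≠ v ∧ ¬ Γ.Adj v w} I) :
    IsIndepDominating Γ A (insert v I) := by
  have hI : ∀ w ∈ I, w ∈ A ∧ w ≠ v ∧ ¬ Γ.Adj v w := fun w hw => mem_filter.1 (h.subset hw)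
  refine ⟨insert_subset hv fun w hw => (hI w hw).1, ?_, fun w hw => ?_⟩
  · simp only [mem_insert, forall_eq_or_imp, Γ.irrefl, not_false_eq_true, true_and]
    exact ⟨fun w hw => (hI w hw).2.2, fun w hw =>
      ⟨fun hwv => (hI w hw).2.2 hwv.symm, h.indep w hw⟩⟩
  · have hdom := h.dom w
    simp only [mem_filter, mem_insert, exists_eq_or_imp] at hdom ⊢
    have := Γ.adj_comm v w
    tauto

/-- Choosing the vertices of `I` by increasing `d`, each one of them accounts for itself and for at
most `d v` neighbours, the deficiency `r - d w` of which is at most `r - d v`. -/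
theorem exists_isIndepDominating_sum_le (d : V → ℕ) (r : ℕ) (A : Finset V)
    (hd : ∀ v ∈ A, degreeIn Γ A v ≤ d v) :
    ∃ I, IsIndepDominating Γ A I ∧ ∑ v ∈ A, (r - d v) ≤ ∑ v ∈ I, (d v + 1) * (r - d v) := by
  classical
  induction A using Finset.strongInduction with
  | H A ih =>
    rcases A.eq_empty_or_nonempty with rfl | hA
    · exact ⟨∅, ⟨subset_rfl, by simp, by simp⟩, by simp⟩
    obtain ⟨v, hv, hmin⟩ := exists_min_image A d hA
    set A' : Finset V := {w ∈ A | w ≠ v ∧ ¬ Γ.Adj v w} with hA'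
    have hA'A : A' ⊆ A := filter_subset _ _
    have hvA' : v ∉ A' := fun h => (mem_filter.1 h).2.1 rfl
    obtain ⟨I, hI, hsum⟩ := ih A' (Finset.ssubset_iff_subset_ne.2 ⟨hA'A, fun h => hvA' (h ▸ hv)⟩)
      fun w hw => (degreeIn_mono hA'A w).trans (hd w (hA'A hw))
    have hremoved : #(A \ A') ≤ d v + 1 := by
      have hsub : A \ A' ⊆ insert v ({w ∈ A | Γ.Adj v w} : Finset V) := fun w hw => by
        simp only [hA', mem_sdiff, mem_filter, mem_insert] at hw ⊢
        tauto
      exact (card_le_card hsub).trans ((card_insert_le _ _).trans (Nat.succ_le_succ (hd v hv)))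
    refine ⟨insert v I, hI.insert hv, ?_⟩
    rw [sum_insert fun h => hvA' (hI.subset h), ← sum_sdiff hA'A]
    gcongr
    calc ∑ w ∈ A \ A', (r - d w)
        ≤ #(A \ A') • (r - d v) := sum_le_card_nsmul _ _ _ fun w hw =>
          Nat.sub_le_sub_left (hmin w (mem_sdiff.1 hw).1) r
      _ ≤ (d v + 1) * (r - d v) := by rw [smul_eq_mul]; gcongr

end Greedy

section AttachColoring

variable {V κ : Type*}

/-- The colouring in which every vertex of `I` has its own colour and passes it on to its neighbours
outside `I`, all other vertices being coloured by `c`. A vertex with several neighbours in `I` takes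
the colour of an arbitrary one. -/
noncomputable def attachColoring (Γ : SimpleGraph V) (I : Finset V) (c : V → κ) (z : V) : V ⊕ κ :=
  open scoped Classical in
  if z ∈ I then .inl z else if h : ∃ w ∈ I, Γ.Adj z w then .inl h.choose else .inr (c z)

variable {Γ : SimpleGraph V} {I U : Finset V} {c : V → κ}

lemma attachColoring_of_mem {v : V} (hv : v ∈ I) :
    attachColoring Γ I c v = .inl v := if_pos hv

variable [DecidableRel Γ.Adj]

lemma attachColoring_of_degreeIn_eq_zero {y : V} (hy : y ∉ I)
    (h : degreeIn Γ I y = 0) : attachColoring Γ I c y = .inr (c y) := by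
  have hnone : ¬ ∃ w ∈ I, Γ.Adj y w := fun hex => (degreeIn_pos.2 hex).ne' h
  rw [attachColoring, if_neg hy, dif_neg hnone]

lemma attachColoring_of_degreeIn_eq_one {x y : V} (hy : y ∉ I)
    (h : degreeIn Γ I y = 1) (hx : x ∈ I) (hyx : Γ.Adj y x) :
    attachColoring Γ I c y = .inl x := by
  have hex : ∃ w ∈ I, Γ.Adj y w := ⟨x, hx, hyx⟩
  rw [attachColoring, if_neg hy, dif_pos hex]
  exact congrArg _ (card_le_one.1 h.le _ (mem_filter.2 hex.choose_spec) _ (mem_filter.2 ⟨hx, hyx⟩))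

variable [DecidableEq V]

lemma attachColoring_eq_of_adj (hIU : Disjoint I U) (hind : ∀ v ∈ I, ∀ w ∈ I, ¬ Γ.Adj v w)
    (hc : ∀ x ∈ U, ∀ y ∈ U, Γ.Adj x y → c x = c y)
    (hU : ∀ y ∈ U, 0 < degreeIn Γ I y → degreeIn Γ I y = 1 ∧ ∀ z ∈ U, c z = c y → z = y)
    {x y : V} (hx : x ∈ I ∪ U) (hy : y ∈ I ∪ U) (hxy : Γ.Adj x y) :
    attachColoring Γ I c x = attachColoring Γ I c y := by
  have hUI : ∀ y ∈ U, y ∉ I := fun y hy hyI => disjoint_left.1 hIU hyI hy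
  have hmixed : ∀ x ∈ I, ∀ y ∈ U, Γ.Adj y x →
      attachColoring Γ I c x = attachColoring Γ I c y := fun x hx y hy hyx => by
    rw [attachColoring_of_mem hx, attachColoring_of_degreeIn_eq_one (hUI y hy)
      (hU y hy (degreeIn_pos.2 ⟨x, hx, hyx⟩)).1 hx hyx]
  rcases mem_union.1 hx with hx | hx <;> rcases mem_union.1 hy with hy | hy
  · exact absurd hxy (hind x hx y hy)
  · exact hmixed x hx y hy hxy.symm
  · exact (hmixed y hy x hx hxy).symm
  have hcxy := hc x hx y hy hxy
  have hx0 : ¬ 0 < degreeIn Γ I x := fun h => hxy.ne ((hU x hx h).2 y hy hcxy.symm).symm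
  have hy0 : ¬ 0 < degreeIn Γ I y := fun h => hxy.ne ((hU y hy h).2 x hx hcxy)
  rw [attachColoring_of_degreeIn_eq_zero (hUI x hx) (Nat.eq_zero_of_not_pos hx0),
    attachColoring_of_degreeIn_eq_zero (hUI y hy) (Nat.eq_zero_of_not_pos hy0), hcxy]

lemma card_add_card_le_card_image_attachColoring [DecidableEq κ] (hIU : Disjoint I U) {A : Finset κ}
    (hA : ∀ a ∈ A, ∃ y ∈ U, c y = a ∧ degreeIn Γ I y = 0) :
    #I + #A ≤ #((I ∪ U).image (attachColoring Γ I c)) := by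
  rw [← card_disjSum]
  refine card_le_card fun a ha => mem_image.2 ?_
  rcases a with v | a
  · have hv : v ∈ I := inl_mem_disjSum.1 ha
    exact ⟨v, mem_union_left U hv, attachColoring_of_mem hv⟩
  · obtain ⟨y, hy, rfl, hy0⟩ := hA a (inr_mem_disjSum.1 ha)
    exact ⟨y, mem_union_right I hy,
      attachColoring_of_degreeIn_eq_zero (fun hyI => disjoint_left.1 hIU hyI hy) hy0⟩

end AttachColoring

section PositiveColors

variable {V κ : Type*} [DecidableEq κ] {U : Finset V} {c : V → κ} {g : V → ℕ}

/-- The colours of `c` on `U` that occur only at vertices of positive weight. -/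
def positiveColors (U : Finset V) (c : V → κ) (g : V → ℕ) : Finset κ :=
  {a ∈ U.image c | ∀ y ∈ U, c y = a → 0 < g y}

lemma positiveColors_subset : positiveColors U c g ⊆ U.image c := filter_subset _ _

lemma card_positiveColors_le : #(positiveColors U c g) ≤ ∑ y ∈ U, g y := by
  have hvertex : ∀ a ∈ positiveColors U c g, 1 ≤ ∑ y ∈ U with c y = a, g y := fun a ha => by
    obtain ⟨y, hy, rfl⟩ := mem_image.1 (mem_filter.1 ha).1
    exact ((mem_filter.1 ha).2 y hy rfl).trans_le
      (single_le_sum (f := g) (fun _ _ => Nat.zero_le _) (mem_filter.2 ⟨hy, rfl⟩))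
  calc #(positiveColors U c g)
      ≤ ∑ a ∈ positiveColors U c g, ∑ y ∈ U with c y = a, g y := by
        rw [card_eq_sum_ones]
        exact sum_le_sum hvertex
    _ ≤ ∑ a ∈ U.image c, ∑ y ∈ U with c y = a, g y := sum_le_sum_of_subset positiveColors_subset
    _ = ∑ y ∈ U, g y := sum_fiberwise_of_maps_to (fun _ => mem_image_of_mem c) g

end PositiveColors

section Cuts

variable {V : Type*} [DecidableEq V]

lemma isPartitionConnected_pair {E : Finset (Sym2 V)} {x y : V} (h : s(x, y) ∈ E) :
    IsPartitionConnected 1 E {x, y} := by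
  intro c
  have hcross : c x ≠ c y → 1 ≤ #(crossEdges E {x, y} c) := fun hne =>
    card_pos.2 ⟨s(x, y), by simp [h, hne]⟩
  have hcard : #(({x, y} : Finset V).image c) ≤ 2 := card_image_le.trans card_le_two
  by_cases hc : c x = c y
  · have : #(({x, y} : Finset V).image c) = 1 := by simp [hc]
    unfold surplus
    omega
  · have := hcross hc
    unfold surplus
    omega

/-- Contracting the crossing edges one by one loses at most one colour for each. -/
lemma exists_const_coloring (E : Finset (Sym2 V)) (X : Finset V) (c : V → V) :
    ∃ d : V → V, (∀ x ∈ X, ∀ y ∈ X, s(x, y) ∈ E → d x = d y) ∧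
      #(X.image c) ≤ #(X.image d) + #(crossEdges E X c) := by
  obtain ⟨d, hcd, hd⟩ := exists_coarse_coloring 1 E X c
  refine ⟨d, fun x hx y hy hxy => hd {x, y} ?_ (isPartitionConnected_pair hxy) x ?_ y ?_, ?_⟩
  · exact insert_subset hx (singleton_subset_iff.2 hy)
  · exact mem_insert_self x {y}
  · exact mem_insert_of_mem (mem_singleton_self y)
  · unfold surplus at hcd
    omega

variable {κ : Type*} [DecidableEq κ]

/-- Deleting `Y` leaves at most one vertex of each positive colour, and that one of weight `1`. It
saves one vertex for each positive colour: either its last vertex is kept, or it has weight at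
least `2`. -/
lemma exists_trimming (U : Finset V) (c : V → κ) (g : V → ℕ) :
    ∃ Y ⊆ U, (∀ y ∈ Y, 0 < g y) ∧ #Y + #(positiveColors U c g) ≤ ∑ y ∈ U, g y ∧
      ∀ y ∈ U \ Y, 0 < g y → g y = 1 ∧ ∀ z ∈ U \ Y, c z = c y → z = y := by
  have hposU : ∀ a ∈ positiveColors U c g, ∃ y ∈ U, c y = a := fun a ha =>
    mem_image.1 (mem_filter.1 ha).1
  obtain ⟨B, hBU, hBinj, hBimage⟩ := exists_subset_injOn_image_eq_of_surjOn (f := c) U _ hposU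
  have hBpos : ∀ y ∈ B, ∀ z ∈ U, c z = c y → 0 < g z := fun y hy =>
    (mem_filter.1 (hBimage ▸ mem_image_of_mem c hy)).2
  set Y : Finset V := {y ∈ U | 0 < g y ∧ ¬ (y ∈ B ∧ g y = 1)} with hY
  refine ⟨Y, filter_subset _ _, fun y hy => (mem_filter.1 hy).2.1, ?_, ?_⟩
  · rw [← hBimage, card_image_of_injOn hBinj, hY, ← filter_mem_eq_inter.trans
      (inter_eq_right.2 hBU), card_filter, card_filter, ← sum_add_distrib]
    refine sum_le_sum fun y hy => ?_
    have := fun hyB => hBpos y hyB y hy rfl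
    split_ifs <;> grind
  · intro y hy hgy
    have hkept : ∀ z ∈ U \ Y, 0 < g z → z ∈ B ∧ g z = 1 := by
      intro z hz hgz
      by_contra hz'
      exact (mem_sdiff.1 hz).2 (mem_filter.2 ⟨(mem_sdiff.1 hz).1, hgz, hz'⟩)
    obtain ⟨hyB, h1⟩ := hkept y hy hgy
    refine ⟨h1, fun z hz hzy => hBinj ?_ hyB hzy⟩
    exact (hkept z hz (hBpos y hyB z (mem_sdiff.1 hz).1 hzy)).1

variable [Fintype V] {Γ : SimpleGraph V} {t : ℝ} {r : ℕ} {S I U : Finset V}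

lemma IsTough.nat_mul_le_card (h : IsTough Γ t) (hrt : r ≤ t) {D : Finset V} {c : V → κ}
    (hc : ∀ x y, x ∉ D → y ∉ D → Γ.Adj x y → c x = c y) {k : ℕ} (hk : 2 ≤ k)
    (hkc : k ≤ #(Dᶜ.image c)) : r * k ≤ #D := by
  have hle := h.mul_le_card (r.cast_nonneg.trans hrt) hc hk hkc
  have : (r : ℝ) * k ≤ t * k := by gcongr
  exact_mod_cast this.trans hle

variable [DecidableRel Γ.Adj]

lemma IsTough.mul_card_le_of_independent (h : IsTough Γ t) (hrt : r ≤ t) (hSI : Disjoint S I)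
    (hind : ∀ v ∈ I, ∀ w ∈ I, ¬ Γ.Adj v w) (hI : 2 ≤ #I) :
    r * #I ≤ #S + ∑ v ∈ I, degreeIn Γ Sᶜ v := by
  set D := S ∪ I.biUnion fun v => {w ∈ Sᶜ | Γ.Adj v w} with hD
  have hID : ∀ v ∈ I, v ∉ D := by
    intro v hv hvD
    simp only [hD, mem_union, mem_biUnion, mem_filter] at hvD
    rcases hvD with hvS | ⟨w, hw, -, hwv⟩
    · exact disjoint_left.1 hSI hvS hv
    · exact hind w hw v hv hwv
  have hisolated : ∀ x y, y ∉ D → Γ.Adj x y → x ∉ I := by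
    intro x y hy hxy hx
    simp only [hD, mem_union, mem_biUnion, mem_filter, mem_compl] at hy
    grind
  have hle : r * #I ≤ #D :=
    h.nat_mul_le_card hrt (c := fun v => if v ∈ I then some v else none)
      (fun x y hx hy hxy => by
        rw [if_neg (hisolated x y hy hxy), if_neg (hisolated y x hx hxy.symm)])
      hI <| by
        rw [← card_image_of_injective I (Option.some_injective V)]
        refine card_le_card fun a ha => ?_
        obtain ⟨v, hv, rfl⟩ := mem_image.1 ha
        exact mem_image.2 ⟨v, mem_compl.2 (hID v hv), if_pos hv⟩
  exact hle.trans ((card_union_le _ _).trans (Nat.add_le_add_left card_biUnion_le _))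

/-- For a single vertex outside `S`, deleting `S` and its neighbours need not disconnect. -/
lemma IsTough.lt_card_add_degreeIn (h : IsTough Γ t) (hr : 1 ≤ r) (hrt : r ≤ t)
    (hn : r + 2 ≤ Fintype.card V) {v : V} (hv : v ∉ S) : r < #S + degreeIn Γ Sᶜ v := by
  set D := S ∪ ({w ∈ Sᶜ | Γ.Adj v w} : Finset V) with hD
  have hcard : #D ≤ #S + degreeIn Γ Sᶜ v := card_union_le _ _
  have hvD : v ∉ D := by simp [hD, hv]
  by_cases hex : ∃ w, w ∉ D ∧ w ≠ v
  · obtain ⟨w, hw, hwv⟩ := hex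
    have hisolated : ∀ x y, y ∉ D → Γ.Adj x y → x ≠ v := by
      rintro x y hy hxy rfl
      simp only [hD, mem_union, mem_filter, mem_compl] at hy
      grind
    have htwo : 2 ≤ #(Dᶜ.image fun x => decide (x = v)) :=
      one_lt_card.2 ⟨_, mem_image_of_mem _ (mem_compl.2 hw), _,
        mem_image_of_mem _ (mem_compl.2 hvD), by simp [hwv]⟩
    have hle : r * 2 ≤ #D :=
      h.nat_mul_le_card hrt (fun x y hx hy hxy => by
        simp [hisolated x y hy hxy, hisolated y x hx hxy.symm]) le_rfl htwo
    omega
  · push Not at hex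
    have hsub : univ ⊆ insert v D := fun w _ => mem_insert.2 (by have := hex w; tauto)
    have := (card_le_card hsub).trans (card_insert_le _ _)
    rw [card_univ] at this
    omega

/-- Each vertex of `I` is separated from the others, and from the colours of `U` that have a vertex
without neighbours in `I`, when suitable neighbours of `I` are deleted. -/
theorem IsTough.mul_add_card_positiveColors_le (h : IsTough Γ t) (hrt : r ≤ t) (hIU : Disjoint I U)
    (hind : ∀ v ∈ I, ∀ w ∈ I, ¬ Γ.Adj v w) {c : V → κ}
    (hc : ∀ x ∈ U, ∀ y ∈ U, Γ.Adj x y → c x = c y)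
    (htwo : 2 ≤ #I + #(U.image c \ positiveColors U c (degreeIn Γ I))) :
    r * (#I + #(U.image c \ positiveColors U c (degreeIn Γ I))) +
      #(positiveColors U c (degreeIn Γ I)) ≤ #(I ∪ U)ᶜ + ∑ y ∈ U, degreeIn Γ I y := by
  obtain ⟨Y, -, hYpos, hYcard, hY⟩ := exists_trimming U c (degreeIn Γ I)
  have hIY : Disjoint I (U \ Y) := hIU.mono_right sdiff_subset
  have hcolors := card_add_card_le_card_image_attachColoring (Γ := Γ) (c := c) hIY
    (A := U.image c \ positiveColors U c (degreeIn Γ I)) fun a ha => by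
      simp only [positiveColors, mem_sdiff, mem_filter, not_and] at ha
      have hzero := ha.2 ha.1
      push Not at hzero
      obtain ⟨y, hy, rfl, hy0⟩ := hzero
      exact ⟨y, mem_sdiff.2 ⟨hy, fun hyY => (hYpos y hyY).not_ge hy0⟩, rfl, Nat.le_zero.1 hy0⟩
  have hle := h.nat_mul_le_card hrt (D := (I ∪ U \ Y)ᶜ) (fun x y hx hy =>
    attachColoring_eq_of_adj hIY hind
      (fun x hx y hy => hc x (mem_sdiff.1 hx).1 y (mem_sdiff.1 hy).1) hY
      (notMem_compl.1 hx) (notMem_compl.1 hy)) htwo (by rwa [compl_compl])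
  have hsub : (I ∪ U \ Y)ᶜ ⊆ (I ∪ U)ᶜ ∪ Y := fun x hx => by
    simp only [mem_compl, mem_union, mem_sdiff] at hx ⊢
    tauto
  have := (card_le_card hsub).trans (card_union_le _ _)
  omega

end Cuts

section FactorCondition

variable {V : Type*} [DecidableEq V] [Fintype V]

/-- The vertices of `T` of degree at most `r` in `Γ \ S`. -/
def lowVertices (Γ : SimpleGraph V) [DecidableRel Γ.Adj] (r : ℕ) (S T : Finset V) : Finset V :=
  {v ∈ T | degreeIn Γ Sᶜ v ≤ r}

/-- The total amount by which the vertices of `I` fall short of degree `r` in `Γ \ S`. -/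
def deficiency (Γ : SimpleGraph V) [DecidableRel Γ.Adj] (r : ℕ) (S I : Finset V) : ℕ :=
  ∑ v ∈ I, (r - degreeIn Γ Sᶜ v)

variable {Γ : SimpleGraph V} [DecidableRel Γ.Adj] {t : ℝ} {r : ℕ} {S T I : Finset V}

lemma deficiency_add_sum_degreeIn (hI : I ⊆ lowVertices Γ r S T) :
    deficiency Γ r S I + ∑ v ∈ I, degreeIn Γ Sᶜ v = r * #I := by
  rw [deficiency, ← sum_add_distrib,
    sum_congr rfl fun v hv => Nat.sub_add_cancel (mem_filter.1 (hI hv)).2, sum_const, smul_eq_mul,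
    mul_comm]

lemma mul_card_add_card_sdiff_le : r * #T + #(T \ lowVertices Γ r S T) ≤
    deficiency Γ r S (lowVertices Γ r S T) + ∑ v ∈ T, degreeIn Γ Sᶜ v := by
  rw [deficiency, lowVertices, ← filter_not, sum_filter, card_filter, mul_comm,
    ← smul_eq_mul, ← sum_const, ← sum_add_distrib, ← sum_add_distrib]
  refine sum_le_sum fun v _ => ?_
  split_ifs <;> omega

lemma exists_isIndepDominating_lowVertices (hST : Disjoint S T) :
    ∃ I, IsIndepDominating Γ (lowVertices Γ r S T) I ∧
      deficiency Γ r S (lowVertices Γ r S T) ≤ r * deficiency Γ r S I := by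
  have hlow : lowVertices Γ r S T ⊆ Sᶜ := fun v hv =>
    mem_compl.2 (disjoint_right.1 hST (mem_filter.1 hv).1)
  obtain ⟨I, hI, hsum⟩ := exists_isIndepDominating_sum_le Γ (degreeIn Γ Sᶜ) r
    (lowVertices Γ r S T) fun v _ => degreeIn_mono hlow v
  refine ⟨I, hI, hsum.trans ?_⟩
  rw [deficiency, mul_sum]
  refine sum_le_sum fun v _ => ?_
  rcases Nat.lt_or_ge (degreeIn Γ Sᶜ v) r with hlt | hge
  · exact Nat.mul_le_mul_right _ hlt
  · simp [Nat.sub_eq_zero_of_le hge]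

lemma disjoint_of_isIndepDominating_lowVertices (hST : Disjoint S T)
    (hI : IsIndepDominating Γ (lowVertices Γ r S T) I) : Disjoint S I :=
  hST.mono_right (hI.subset.trans (filter_subset _ _))

lemma deficiency_lt_card (h : IsTough Γ t) (hr : 1 ≤ r) (hrt : r ≤ t)
    (hn : r + 2 ≤ Fintype.card V) (hSI : Disjoint S I) (hIT : I ⊆ lowVertices Γ r S T)
    (hI : #I = 1) : deficiency Γ r S I < #S := by
  have hsum := deficiency_add_sum_degreeIn hIT
  obtain ⟨v, rfl⟩ := card_eq_one.1 hI
  have := h.lt_card_add_degreeIn hr hrt hn (disjoint_singleton_right.1 hSI)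
  rw [sum_singleton, card_singleton] at hsum
  omega

lemma deficiency_le_card (h : IsTough Γ t) (hr : 1 ≤ r) (hrt : r ≤ t)
    (hn : r + 2 ≤ Fintype.card V) (hSI : Disjoint S I)
    (hI : IsIndepDominating Γ (lowVertices Γ r S T) I) : deficiency Γ r S I ≤ #S := by
  rcases I.eq_empty_or_nonempty with rfl | hne
  · simp [deficiency]
  rcases (Nat.succ_le_of_lt hne.card_pos).eq_or_lt with hcard | hcard
  · exact (deficiency_lt_card h hr hrt hn hSI hI.subset hcard.symm).le
  · have := h.mul_card_le_of_independent hrt hSI hI.indep hcard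
    have := deficiency_add_sum_degreeIn hI.subset
    omega

lemma card_compl_union_compl_le : #(I ∪ (S ∪ T)ᶜ)ᶜ ≤
    #S + #(T \ lowVertices Γ r S T) + #(lowVertices Γ r S T \ I) := by
  have hsub : (I ∪ (S ∪ T)ᶜ)ᶜ ⊆ S ∪ T \ lowVertices Γ r S T ∪ lowVertices Γ r S T \ I := by
    intro v hv
    simp only [mem_compl, mem_union, mem_sdiff] at hv ⊢
    tauto
  exact (card_le_card hsub).trans ((card_union_le _ _).trans
    (Nat.add_le_add_right (card_union_le _ _) _))

lemma IsIndepDominating.card_sdiff_add_sum_degreeIn_le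
    (hI : IsIndepDominating Γ (lowVertices Γ r S T) I) (hST : Disjoint S T) :
    #(lowVertices Γ r S T \ I) + ∑ y ∈ (S ∪ T)ᶜ, degreeIn Γ I y ≤ ∑ v ∈ I, degreeIn Γ Sᶜ v := by
  have hT : lowVertices Γ r S T \ I ⊆ T := sdiff_subset.trans (filter_subset _ _)
  refine card_add_sum_degreeIn_le ?_ (fun v hv => mem_compl.2 (disjoint_right.1 hST (hT hv)))
    (compl_subset_compl.2 subset_union_left) fun v hv => ?_
  · exact disjoint_compl_right.mono_left (hT.trans subset_union_right)
  · exact (hI.dom v (mem_sdiff.1 hv).1).resolve_left (mem_sdiff.1 hv).2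

lemma card_image_add_deficiency_le (h : IsTough Γ t) (hr : 1 ≤ r) (hrt : r ≤ t)
    (hST : Disjoint S T) (hT : T.Nonempty) (hI : IsIndepDominating Γ (lowVertices Γ r S T) I)
    {κ : Type*} [DecidableEq κ] {c : V → κ}
    (hc : ∀ x ∈ (S ∪ T)ᶜ, ∀ y ∈ (S ∪ T)ᶜ, Γ.Adj x y → c x = c y)
    (htwo : #I = 1 → 2 ≤ #((S ∪ T)ᶜ.image c)) :
    #((S ∪ T)ᶜ.image c) + deficiency Γ r S I ≤ #S + #(T \ lowVertices Γ r S T) := by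
  have hlow : lowVertices Γ r S T ⊆ T := filter_subset _ _
  have hTcard := card_sdiff_add_card_eq_card hlow
  have hlowcard := card_sdiff_add_card_eq_card hI.subset
  have hcolors := card_sdiff_add_card_eq_card
    (positiveColors_subset (U := (S ∪ T)ᶜ) (c := c) (g := degreeIn Γ I))
  have hpos := card_positiveColors_le (U := (S ∪ T)ᶜ) (c := c) (g := degreeIn Γ I)
  have hdegree := hI.card_sdiff_add_sum_degreeIn_le hST
  have hsum := deficiency_add_sum_degreeIn hI.subset
  by_cases hcut : 2 ≤ #I + #((S ∪ T)ᶜ.image c \ positiveColors (S ∪ T)ᶜ c (degreeIn Γ I))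
  · have hIU : Disjoint I (S ∪ T)ᶜ := disjoint_compl_right.mono_left
      ((hI.subset.trans hlow).trans subset_union_right)
    have hle := h.mul_add_card_positiveColors_le hrt hIU hI.indep hc hcut
    rw [mul_add] at hle
    have := card_compl_union_compl_le (Γ := Γ) (r := r) (S := S) (T := T) (I := I)
    have := Nat.mul_le_mul_right
      #((S ∪ T)ᶜ.image c \ positiveColors (S ∪ T)ᶜ c (degreeIn Γ I)) hr
    omega
  rcases Nat.eq_zero_or_pos #I with hI0 | hI0
  · have : ∑ v ∈ I, degreeIn Γ Sᶜ v = 0 := by rw [card_eq_zero.1 hI0, sum_empty]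
    have := hT.card_pos
    rw [hI0] at hsum
    omega
  · have hI1 : #I = 1 := by omega
    have hle := h.nat_mul_le_card hrt (D := S ∪ T)
      (fun x y hx hy => hc x (mem_compl.2 hx) y (mem_compl.2 hy)) (htwo hI1) le_rfl
    have := card_union_le S T
    have := Nat.mul_le_mul_left r (htwo hI1)
    rw [hI1] at hsum
    omega

theorem card_image_add_mul_card_le (h : IsTough Γ t) (hr : 1 ≤ r) (hrt : r ≤ t)
    (hn : r + 2 ≤ Fintype.card V) (hST : Disjoint S T) (hT : T.Nonempty)
    {κ : Type*} [DecidableEq κ] {c : V → κ}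
    (hc : ∀ x ∈ (S ∪ T)ᶜ, ∀ y ∈ (S ∪ T)ᶜ, Γ.Adj x y → c x = c y) :
    #((S ∪ T)ᶜ.image c) + r * #T ≤ r * #S + ∑ v ∈ T, degreeIn Γ Sᶜ v := by
  obtain ⟨I, hI, hlow⟩ := exists_isIndepDominating_lowVertices (Γ := Γ) (r := r) hST
  have hSI := disjoint_of_isIndepDominating_lowVertices hST hI
  have htotal := mul_card_add_card_sdiff_le (Γ := Γ) (r := r) (S := S) (T := T)
  suffices #((S ∪ T)ᶜ.image c) + r * deficiency Γ r S I ≤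
      r * #S + #(T \ lowVertices Γ r S T) by omega
  obtain ⟨k, rfl⟩ := Nat.exists_eq_add_of_le' hr
  by_cases hexc : #I = 1 ∧ #((S ∪ T)ᶜ.image c) < 2
  · have hlt := deficiency_lt_card h hr hrt hn hSI hI.subset hexc.1
    have := Nat.mul_le_mul_left (k + 1) hlt
    rw [Nat.succ_eq_add_one, mul_add] at this
    omega
  · have hle := Nat.mul_le_mul_left k (deficiency_le_card h hr hrt hn hSI hI)
    have := card_image_add_deficiency_le h hr hrt hST hT hI hc (by omega)
    rw [add_mul, add_mul]
    omega

end FactorCondition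

section NearlyRegularFactor

variable {V : Type*} [Fintype V]

variable (V) in
lemma exists_even_sum_add (r : ℕ) [Nonempty V] :
    ∃ ε : V → ℕ, ∑ v, ε v ≤ 1 ∧ Even (∑ v, (r + ε v)) := by
  classical
  by_cases hpar : Even (Fintype.card V * r)
  · exact ⟨fun _ => 0, by simp, by simpa using hpar⟩
  · refine ⟨Pi.single (Classical.arbitrary V) 1, by simp, ?_⟩
    simpa [sum_add_distrib] using (Nat.not_even_iff_odd.1 hpar).add_one

variable [DecidableEq V] {Γ : SimpleGraph V} {t : ℝ} {r : ℕ}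

lemma IsTough.adj_of_card_eq (h : IsTough Γ t) (hrt : r ≤ t) (hn : Fintype.card V = r + 1)
    {x y : V} (hxy : x ≠ y) : Γ.Adj x y := by
  by_contra hno
  have hle : r * 2 ≤ #({x, y} : Finset V)ᶜ := h.nat_mul_le_card hrt (c := id)
    (fun a b ha hb hab => by
      simp only [mem_compl, mem_insert, mem_singleton, not_not] at ha hb
      have := hab.ne
      have := fun h : Γ.Adj y x => hno h.symm
      grind) le_rfl (by rw [compl_compl, image_id, card_pair hxy])
  have hpair := card_le_univ ({x, y} : Finset V)
  rw [card_pair hxy] at hpair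
  rw [card_compl, card_pair hxy] at hle
  omega

lemma IsTough.isNearlyRegular_edgeFinset [DecidableRel Γ.Adj] (h : IsTough Γ t) (hrt : r ≤ t)
    (hn : Fintype.card V = r + 1) : IsNearlyRegular r Γ.edgeFinset := by
  have hdegree : ∀ v, edgeDegree Γ.edgeFinset v = r := by
    intro v
    have hnbrs : Γ.neighborFinset v = univ.erase v := by
      ext w
      simp only [SimpleGraph.mem_neighborFinset, mem_erase, mem_univ, and_true]
      exact ⟨fun hvw => hvw.ne', fun hwv => h.adj_of_card_eq hrt hn hwv.symm⟩
    rw [edgeDegree_edgeFinset, ← Γ.card_neighborFinset_eq_degree, hnbrs,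
      card_erase_of_mem (mem_univ v), card_univ, hn, Nat.add_sub_cancel]
  exact ⟨fun v => (hdegree v).ge, by simp [hdegree]⟩

lemma IsTough.factor_condition [DecidableRel Γ.Adj] (h : IsTough Γ t) (hr : 1 ≤ r)
    (hrt : r ≤ t) (hn : r + 2 ≤ Fintype.card V) {ε : V → ℕ} (hε : ∑ v, ε v ≤ 1)
    {S T : Finset V} (hST : Disjoint S T) (c : V → V) :
    #((S ∪ T)ᶜ.image c) + ∑ v ∈ T, (r + ε v) ≤
      ∑ v ∈ S, (r + ε v) + ∑ v ∈ T, degreeIn Γ Sᶜ v +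
        #(crossEdges Γ.edgeFinset (S ∪ T)ᶜ c) + 1 := by
  obtain ⟨d, hd, hle⟩ := exists_const_coloring Γ.edgeFinset (S ∪ T)ᶜ c
  replace hd : ∀ x ∈ (S ∪ T)ᶜ, ∀ y ∈ (S ∪ T)ᶜ, Γ.Adj x y → d x = d y :=
    fun x hx y hy hxy => hd x hx y hy (by simpa using hxy)
  have hsum : ∀ A : Finset V, ∑ v ∈ A, (r + ε v) = r * #A + ∑ v ∈ A, ε v := fun A => by
    rw [sum_add_distrib, sum_const, smul_eq_mul, mul_comm]
  have hεT : ∑ v ∈ T, ε v ≤ 1 := (sum_le_sum_of_subset (subset_univ T)).trans hε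
  suffices #((S ∪ T)ᶜ.image d) + r * #T ≤ r * #S + ∑ v ∈ T, degreeIn Γ Sᶜ v ∨
      T = ∅ ∧ #((S ∪ T)ᶜ.image d) ≤ 1 by
    rw [hsum, hsum]
    rcases this with hle' | ⟨rfl, hle'⟩
    · omega
    · simp only [card_empty, sum_empty, mul_zero] at *
      omega
  rcases T.eq_empty_or_nonempty with rfl | hT
  · by_cases htwo : 2 ≤ #((S ∪ ∅)ᶜ.image d)
    · have hcut := h.nat_mul_le_card hrt (D := S ∪ ∅)
        (fun x y hx hy => hd x (mem_compl.2 hx) y (mem_compl.2 hy)) htwo le_rfl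
      rw [union_empty] at hcut htwo ⊢
      have := Nat.mul_le_mul_right #(Sᶜ.image d) hr
      have := Nat.mul_le_mul_right #S hr
      simp only [card_empty, mul_zero, sum_empty]
      omega
    · exact .inr ⟨rfl, by omega⟩
  · exact .inl (card_image_add_mul_card_le h hr hrt hn hST hT hd)

theorem IsTough.exists_isNearlyRegular (h : IsTough Γ t) (hr : 1 ≤ r) (hrt : r ≤ t)
    (hn : r + 1 ≤ Fintype.card V) :
    ∃ F : Finset (Sym2 V), (∀ e ∈ F, e ∈ Γ.edgeSet) ∧ IsNearlyRegular r F := by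
  classical
  rcases hn.eq_or_lt with hn | hn
  · exact ⟨Γ.edgeFinset, fun e => SimpleGraph.mem_edgeFinset.1,
      h.isNearlyRegular_edgeFinset hrt hn.symm⟩
  have : Nonempty V := Fintype.card_pos_iff.1 (by omega)
  obtain ⟨ε, hε, heven⟩ := exists_even_sum_add V r
  have hdegree : ∀ v, r + ε v ≤ Γ.degree v := by
    intro v
    have hcond := h.factor_condition hr hrt hn hε (disjoint_empty_left {v}) fun _ => v
    have hcross : crossEdges Γ.edgeFinset (∅ ∪ {v} : Finset V)ᶜ (fun _ => v) = ∅ := by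
      ext e
      induction e with
      | _ x y => simp
    have hne : ((∅ ∪ {v} : Finset V)ᶜ).Nonempty := by
      rw [← card_pos, empty_union, card_compl, card_singleton]
      omega
    rw [hcross, image_const hne, sum_singleton, sum_singleton, sum_empty, compl_empty,
      degreeIn_univ, card_singleton, card_empty] at hcond
    omega
  obtain ⟨F, hF, hdeg⟩ := exists_factor heven hdegree
    fun S T hST c => h.factor_condition hr hrt hn hε hST c
  exact ⟨F, hF, fun v => by rw [hdeg]; omega, by simpa [hdeg] using hε⟩

end NearlyRegularFactor

/-! ### Graphs with parallel edges -/

section Transfer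

variable {α β : Type*} {G : Graph α β}

variable (G) in
/-- The simple graph on the vertices of `G` in which two distinct vertices are adjacent if some edge
of `G` joins them. -/
def simplification : SimpleGraph V(G) where
  Adj x y := x ≠ y ∧ G.Adj x y
  symm := ⟨fun _ _ h => ⟨h.1.symm, h.2.symm⟩⟩
  loopless := ⟨fun _ h => h.1 rfl⟩

lemma eq_of_joined_deleteVerts {κ : Type*} {S : Finset V(G)} {c : V(G) → κ}
    (hc : ∀ x y, x ∉ S → y ∉ S → (simplification G).Adj x y → c x = c y) {x : V(G)} {y : α}
    (h : (G.deleteVerts (Subtype.val '' (S : Set V(G)))).Joined x y) :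
    ∃ hy : y ∈ V(G), c x = c ⟨y, hy⟩ := by
  obtain ⟨-, h⟩ := h
  induction h with
  | refl => exact ⟨x.2, rfl⟩
  | @tail y z _ hyz ih =>
    obtain ⟨hy, hxy⟩ := ih
    obtain ⟨e, he⟩ := hyz
    obtain ⟨he, hyS, hzS⟩ := (G.deleteVerts_isLink _).1 he
    refine ⟨he.right_mem, hxy.trans ?_⟩
    by_cases hne : y = z
    · subst hne
      rfl
    · refine hc _ _ ?_ ?_ ⟨fun h => hne (congrArg Subtype.val h), e, he⟩
      · exact fun h => hyS ⟨_, h, rfl⟩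
      · exact fun h => hzS ⟨_, h, rfl⟩

lemma finite_componentSets (hV : V(G).Finite) : G.componentSets.Finite :=
  (hV.image fun x => {y | G.Joined x y}).subset fun _ ⟨x, hx, hC⟩ => ⟨x, hx, hC.symm⟩

lemma card_image_compl_le_numComponents [Fintype V(G)] [DecidableEq V(G)] {κ : Type*}
    [DecidableEq κ] {S : Finset V(G)} {c : V(G) → κ}
    (hc : ∀ x y, x ∉ S → y ∉ S → (simplification G).Adj x y → c x = c y) :
    #(Sᶜ.image c) ≤ (G.deleteVerts (Subtype.val '' (S : Set V(G)))).numComponents := by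
  classical
  set G' := G.deleteVerts (Subtype.val '' (S : Set V(G))) with hG'
  have hV : ∀ x ∈ Sᶜ, x.1 ∈ V(G') := fun x hx => by
    simpa [hG'] using hx
  calc #(Sᶜ.image c)
      ≤ #(Sᶜ.image fun x : V(G) => {y | G'.Joined x y}) := by
        refine card_image_le_card_image fun x _ y hy hxy => ?_
        have hjoined : G'.Joined x y := by
          have : y.1 ∈ {z | G'.Joined y z} := ⟨hV y hy, .refl⟩
          exact hxy.symm.subset this
        exact (eq_of_joined_deleteVerts hc hjoined).2
    _ ≤ G'.numComponents := by
        rw [Graph.numComponents, ← Set.ncard_coe_finset]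
        have hfin : V(G').Finite := (Set.toFinite V(G)).subset (by simp [hG'])
        refine Set.ncard_le_ncard (fun C hC => ?_) (finite_componentSets hfin)
        obtain ⟨x, hx, rfl⟩ := mem_image.1 (mem_coe.1 hC)
        exact ⟨x, hV x hx, rfl⟩

lemma isTough_simplification [Fintype V(G)] [DecidableEq V(G)] {t : ℝ} (ht : 0 < t)
    (h : G.IsTough t) : IsTough (simplification G) t := by
  intro S c hc htwo
  have hle := h (Subtype.val '' (S : Set V(G))) (by rintro _ ⟨x, -, rfl⟩; exact x.2)
  rw [Set.ncard_image_of_injective _ Subtype.val_injective, Set.ncard_coe_finset] at hle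
  have hcolors : (#(Sᶜ.image c) : ℝ) ≤ max 1 (1 / t * #S) :=
    le_trans (mod_cast card_image_compl_le_numComponents hc) hle
  have htwo' : (2 : ℝ) ≤ #(Sᶜ.image c) := mod_cast htwo
  have hcolors' := (le_max_iff.1 hcolors).resolve_left (by linarith)
  rwa [one_div, ← div_eq_inv_mul, le_div_iff₀ ht, mul_comm] at hcolors'

/-- `φ` selects, among the parallel edges of `G` that join two given vertices, one of them. The
values of `φ` at pairs of vertices that are not adjacent are irrelevant. -/
def IsEdgeChoice (φ : Sym2 V(G) → β) : Prop :=
  ∀ x y, (simplification G).Adj x y → G.IsLink (φ s(x, y)) x y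

lemma exists_isEdgeChoice {e : Sym2 V(G)} (he : e ∈ (simplification G).edgeSet) :
    ∃ φ : Sym2 V(G) → β, IsEdgeChoice φ := by
  have : Nonempty β := by
    induction e with
    | _ x y => exact he.2.nonempty
  have hex : ∀ e : Sym2 V(G), ∃ b : β, ∀ x y, s(x, y) = e → (simplification G).Adj x y →
      G.IsLink b x y := by
    intro e
    induction e with
    | _ a b =>
      by_cases hab : G.Adj a b
      · obtain ⟨f, hf⟩ := hab
        refine ⟨f, fun x y hxy _ => ?_⟩
        rcases Sym2.eq_iff.1 hxy with ⟨rfl, rfl⟩ | ⟨rfl, rfl⟩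
        exacts [hf, hf.symm]
      · refine ⟨Classical.arbitrary β, fun x y hxy h => absurd ?_ hab⟩
        rcases Sym2.eq_iff.1 hxy with ⟨rfl, rfl⟩ | ⟨rfl, rfl⟩
        exacts [h.2, h.2.symm]
  choose φ hφ using hex
  exact ⟨φ, fun x y => hφ _ x y rfl⟩

variable {φ : Sym2 V(G) → β} {F : Finset (Sym2 V(G))}

lemma IsEdgeChoice.eq_of_isLink (hφ : IsEdgeChoice φ) {e : Sym2 V(G)}
    (he : e ∈ (simplification G).edgeSet) {x y : V(G)} (hxy : G.IsLink (φ e) x y) :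
    e = s(x, y) := by
  induction e with
  | _ a b =>
    rw [Sym2.eq_iff, Subtype.ext_iff, Subtype.ext_iff, Subtype.ext_iff, Subtype.ext_iff]
    exact (hφ a b he).eq_and_eq_or_eq_and_eq hxy

lemma IsEdgeChoice.injOn (hφ : IsEdgeChoice φ) : Set.InjOn φ (simplification G).edgeSet := by
  intro e he f hf hef
  induction f with
  | _ x y => exact hφ.eq_of_isLink he (hef ▸ hφ x y hf)

lemma IsEdgeChoice.restrict_isLink (hφ : IsEdgeChoice φ)
    (hF : ∀ e ∈ F, e ∈ (simplification G).edgeSet) {b : β} {x y : V(G)} :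
    (G.restrict (φ '' F)).IsLink b x y ↔ s(x, y) ∈ F ∧ φ s(x, y) = b := by
  rw [Graph.restrict_isLink]
  constructor
  · rintro ⟨⟨e, he, rfl⟩, hxy⟩
    obtain rfl := hφ.eq_of_isLink (hF e he) hxy
    exact ⟨he, rfl⟩
  · rintro ⟨he, rfl⟩
    exact ⟨⟨_, he, rfl⟩, hφ x y (hF _ he)⟩

lemma IsEdgeChoice.incidenceSet_restrict [DecidableEq V(G)] (hφ : IsEdgeChoice φ)
    (hF : ∀ e ∈ F, e ∈ (simplification G).edgeSet) (v : V(G)) :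
    (G.restrict (φ '' F)).incidenceSet v = φ '' ({e ∈ F | v ∈ e} : Finset (Sym2 V(G))) := by
  ext b
  rw [Graph.mem_incidenceSet]
  constructor
  · rintro ⟨y, hy⟩
    obtain ⟨he, hb⟩ := (hφ.restrict_isLink hF (y := ⟨y, hy.right_mem⟩)).1 hy
    exact ⟨_, mem_coe.2 (mem_filter.2 ⟨he, Sym2.mem_mk_left _ _⟩), hb⟩
  · rintro ⟨e, he, rfl⟩
    obtain ⟨heF, w, rfl⟩ := mem_filter.1 (mem_coe.1 he)
    exact ⟨w, (hφ.restrict_isLink hF).2 ⟨heF, rfl⟩⟩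

lemma IsEdgeChoice.vertexDegree_restrict [DecidableEq V(G)] (hφ : IsEdgeChoice φ)
    (hF : ∀ e ∈ F, e ∈ (simplification G).edgeSet) (v : V(G)) :
    (G.restrict (φ '' F)).vertexDegree v = edgeDegree F v := by
  have hloop : (G.restrict (φ '' F)).loopSet v = ∅ := by
    refine Set.eq_empty_of_forall_notMem fun b hb => ?_
    exact (hF _ ((hφ.restrict_isLink hF).1 hb).1 : (simplification G).Adj v v).1 rfl
  have hinj : Set.InjOn φ ({e ∈ F | v ∈ e} : Finset (Sym2 V(G))) :=
    hφ.injOn.mono fun e he => hF e (mem_filter.1 (mem_coe.1 he)).1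
  rw [Graph.vertexDegree, hloop, hφ.incidenceSet_restrict hF, Set.ncard_empty, add_zero,
    hinj.ncard_image, Set.ncard_coe_finset, edgeDegree]

lemma IsEdgeChoice.isTreeGraph_restrict [Fintype V(G)] [DecidableEq V(G)] [Nonempty V(G)]
    (hφ : IsEdgeChoice φ) (hF : ∀ e ∈ F, e ∈ (simplification G).edgeSet) (hind : IsIndepEdgeSet F)
    (hcard : #F + 1 = Fintype.card V(G)) : (G.restrict (φ '' F)).IsTreeGraph := by
  refine ⟨⟨Set.nonempty_coe_sort.1 ‹_›, fun x hx y hy => ⟨hx, ?_⟩⟩, ?_⟩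
  · exact (hind.reflTransGen hcard ⟨x, hx⟩ ⟨y, hy⟩).lift Subtype.val fun a b hab =>
      ⟨_, (hφ.restrict_isLink hF).2 ⟨hab, rfl⟩⟩
  · rintro k ⟨v, e, -, he, hv⟩
    let w : Fin (k + 1) → V(G) := fun i => ⟨v i, (hv i).left_mem⟩
    have hw : ∀ i, s(w i, w (i + 1)) ∈ F ∧ φ s(w i, w (i + 1)) = e i := fun i =>
      (hφ.restrict_isLink hF).1 (hv i)
    refine hind.not_injective_cycle w (fun i => (hw i).1) fun i j hij => he ?_
    rw [← (hw i).2, ← (hw j).2]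
    exact congrArg φ hij

lemma IsEdgeChoice.isTreeConnected_restrict [Fintype V(G)] [Nonempty V(G)] [DecidableEq V(G)]
    {m : ℕ} (hφ : IsEdgeChoice φ) (hF : ∀ e ∈ F, e ∈ (simplification G).edgeSet)
    (hconn : IsPartitionConnected m F univ) : (G.restrict (φ '' F)).IsTreeConnected m := by
  obtain ⟨I, hIF, hdisj, hI⟩ := exists_tree_packing hconn
  have hIG : ∀ i, ∀ e ∈ I i, e ∈ (simplification G).edgeSet := fun i e he => hF e (hIF i he)
  refine ⟨fun i => G.restrict (φ '' I i), fun i => ⟨⟨?_, rfl⟩, ?_⟩, fun i j hij => ?_⟩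
  · exact G.restrict_mono_right (Set.image_mono (coe_subset.2 (hIF i)))
  · exact hφ.isTreeGraph_restrict (hIG i) (hI i).1 (hI i).2
  · refine Set.disjoint_left.2 ?_
    rintro b ⟨-, e, he, rfl⟩ ⟨-, f, hf, hef⟩
    obtain rfl := hφ.injOn (hIG j f hf) (hIG i e he) hef
    exact disjoint_left.1 (hdisj hij) he hf

end Transfer

end TreeFactor

theorem mainTheorem8_general {α β : Type*} (G : Graph α β) (m r : ℕ) (t : ℝ) (hm : 1 ≤ m)
    (hr : 2 * m ≤ r)
    (ht : max (2 * (m : ℝ) * (r : ℝ) / ((r : ℝ) + 1 - 2 * (m : ℝ))) (r : ℝ) ≤ t)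
    (htough : G.IsTough t) (hcard : r + 1 ≤ V(G).ncard) :
    ∃ H : Graph α β, H ≤s G ∧ H.IsTreeConnected m ∧
      ∀ v ∈ V(H), H.vertexDegree v = r ∨ H.vertexDegree v = r + 1 := by
  classical
  have : Fintype V(G) := (Set.finite_of_ncard_pos (by omega)).fintype
  rw [← Nat.card_coe_set_eq, Nat.card_eq_fintype_card] at hcard
  have : Nonempty V(G) := Fintype.card_pos_iff.1 (by omega)
  have hrt : (r : ℝ) ≤ t := (le_max_right _ _).trans ht
  have hrm : (2 : ℝ) * m ≤ r := mod_cast hr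
  have ht' : 2 * (m : ℝ) * r ≤ t * (r + 1 - 2 * m) :=
    (div_le_iff₀ (by linarith)).1 ((le_max_left _ _).trans ht)
  have hpos : 0 < t := lt_of_lt_of_le (by norm_cast; omega) hrt
  have hsimple := TreeFactor.isTough_simplification hpos htough
  obtain ⟨F, hF, hreg⟩ := hsimple.exists_isNearlyRegular (by omega) hrt hcard
  obtain ⟨H, hH, hconn, hdeg⟩ := hsimple.exists_isPartitionConnected_union hm hr ht' hF hreg
  obtain ⟨φ, hφ⟩ : ∃ φ, TreeFactor.IsEdgeChoice (G := G) φ := by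
    obtain ⟨v⟩ := this
    have hvH : 0 < TreeFactor.edgeDegree H v := by have := hdeg v; omega
    obtain ⟨e, he⟩ := Finset.card_pos.1 hvH
    exact TreeFactor.exists_isEdgeChoice (hH e (Finset.mem_filter.1 he).1)
  refine ⟨G.restrict (φ '' H), ⟨Graph.restrict_le, rfl⟩, hφ.isTreeConnected_restrict hH hconn,
    fun x hx => ?_⟩
  rw [hφ.vertexDegree_restrict hH ⟨x, hx⟩]
  exact hdeg ⟨x, hx⟩

theorem mainTheorem8 {α β : Type*} (G : Graph α β)
    (hV : V(G).Finite) (hE : E(G).Finite) (hloopless : G.Loopless)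
    (m r : ℕ) (t : ℝ) (hm : 1 ≤ m) (hr : 2 * m ≤ r)
    (ht : max (2 * (m : ℝ) * (r : ℝ) / ((r : ℝ) + 1 - 2 * (m : ℝ))) (r : ℝ) ≤ t)
    (htough : G.IsTough t) (hcard : r + 1 ≤ V(G).ncard) :
    ∃ H : Graph α β, H ≤s G ∧ H.IsTreeConnected m ∧
      ∀ v ∈ V(H), H.vertexDegree v = r ∨ H.vertexDegree v = r + 1 :=
  mainTheorem8_general G m r t hm hr ht htough hcard
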